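/- For a non-empty bipartite graph $G=(U,V,E)$ with $E\subseteq U\times V$ and an integer $\ell\ge 0$, an $\ell$-left independent set of $G$ is an independent set $S\subseteq U\cup V$ with $|S\cap U|=\ell$, and $\mathrm{IS}^{(\ell)}(G)$ denotes the number of $\ell$-left independent sets of $G$. For a real number $c\ge 0$, let $\mathrm{Apx}_c$ be the following parameterised problem. Input: a bipartite graph $G=(U,V,E)$ on $n\ge 1$ vertices and an integer $\ell\ge 0$. Output: a (rational) number $z$ such that $$n^{-c}\cdot \mathrm{IS}^{(\ell)}(G)\;\le\; z\;\le\; n^{c}\cdot \mathrm{IS}^{(\ell)}(G).$$ Parameter: $\ell$. **Theorem.** For every $c\ge 0$, the problem $\mathrm{Apx}_c$ is both NP-hard and W[1]-hard. Here NP-hard means that every language $L\in\mathrm{NP}$ has a polynomial-time Turing reduction to $\mathrm{Apx}_c$: there is a polynomial-time algorithm that decides $L$ when it is given any oracle which answers each instance of $\mathrm{Apx}_c$ by some number $z$ that is correct for it. W[1]-hard means that there is an FPT Turing reduction to $\mathrm{Apx}_c$ from the problem $\mathrm{Clique}$ (given a graph $G$ and an integer $k\ge 1$, does $G$ contain a $k$-clique?),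 parameterised by $k$: there are computable functions $f,g:\mathbb N\to\mathbb N$, a constant $d\in\mathbb N$ and an algorithm that, given any such oracle, decides each instance $x$ of $\mathrm{Clique}$ with parameter $k$ in time at most $f(k)\cdot|x|^{d}$ and queries only instances $(G',\ell)$ with $\ell\le g(k)$. The algorithms run on a random access machine over the natural numbers with addition, truncated subtraction and halving at unit cost; oracle answers are given by their numerator and denominator. -/

import Mathlib

/-! ### The class NP -/

/-- A nondeterministic one-tape Turing machine with finite alphabet `Γ` and finite state set `Λ`.
The blank symbol is `default`, and the two input symbols `sym false`, `sym true` are distinct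
nonblank symbols. -/
structure NTM where
  Γ : Type
  Λ : Type
  [finΓ : Finite Γ]
  [finΛ : Finite Λ]
  [inhΓ : Inhabited Γ]
  sym : Bool → Γ
  sym_injective : Function.Injective sym
  sym_ne_blank : ∀ b, sym b ≠ default
  start : Λ
  accept : Set Λ
  /-- `(q', s, d) ∈ trans q a`: in state `q` reading `a`, the machine may write `s`, move the head
  in direction `d` and enter state `q'`. -/
  trans : Λ → Γ → Set (Λ × Γ × Turing.Dir)

namespace NTM

attribute [instance] NTM.finΓ NTM.finΛ NTM.inhΓ

/-- A configuration: the state, and the two-way infinite tape with its head. -/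
structure Cfg (M : NTM) where
  state : M.Λ
  tape : Turing.Tape M.Γ

/-- The initial configuration: the input is on the tape, the head on its first symbol. -/
def init (M : NTM) (x : List Bool) : M.Cfg :=
  ⟨M.start, Turing.Tape.mk₁ (x.map M.sym)⟩

/-- One computation step. -/
def Step (M : NTM) (C D : M.Cfg) : Prop :=
  ∃ (s : M.Γ) (d : Turing.Dir),
    (D.state, s, d) ∈ M.trans C.state C.tape.head ∧ D.tape = (C.tape.write s).move d

/-- Some computation of `M` on input `x` reaches an accepting state within `T` steps. -/
def AcceptsWithin (M : NTM) (x : List Bool) (T : ℕ) : Prop :=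
  ∃ (t : ℕ) (C : ℕ → M.Cfg), t ≤ T ∧ C 0 = M.init x ∧
    (∀ i < t, M.Step (C i) (C (i + 1))) ∧ (C t).state ∈ M.accept

end NTM

/-- `L ∈ NP`: a nondeterministic Turing machine accepts exactly the words of `L`, with accepting
computations of length polynomial in the length of the word. -/
def InNP (L : Set (List Bool)) : Prop :=
  ∃ (M : NTM) (p : Polynomial ℕ), ∀ x, x ∈ L ↔ M.AcceptsWithin x (p.eval x.length)

/-! ### Random access machines with an oracle

The machine has registers `R 0, R 1, …` holding natural numbers, all initially zero, indirect
addressing, a read-only random access input (a list of numbers) and a write-only query list.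
Every instruction takes one unit of time.  The arithmetic is addition, truncated subtraction and
halving, without multiplication, so that numbers grow by at most one bit per step and unit-cost
time is polynomially equivalent to Turing machine time. -/

/-- The instructions. Jump targets are positions in the program. -/
inductive Instr where
  /-- `R i := v` -/
  | const (i v : ℕ)
  /-- `R i := R j` -/
  | copy (i j : ℕ)
  /-- `R i := R j + R k` -/
  | add (i j k : ℕ)
  /-- `R i := max (R j - R k) 0` -/
  | sub (i j k : ℕ)
  /-- `R i := ⌊R j / 2⌋` -/
  | half (i j : ℕ)
  /-- `R i := R (R j)` -/
  | load (i j : ℕ)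
  /-- `R (R i) := R j` -/
  | store (i j : ℕ)
  /-- `R i :=` the length of the input list -/
  | inputLength (i : ℕ)
  /-- `R i :=` the entry number `R j` of the input list (counted from 0; 0 beyond its end) -/
  | input (i j : ℕ)
  /-- go to position `l` -/
  | jump (l : ℕ)
  /-- if `R i = 0` go to position `l` -/
  | jumpZero (i l : ℕ)
  /-- append `R i` to the query list -/
  | emit (i : ℕ)
  /-- submit the query list to the oracle, store the numerator and the denominator of the answer
  in `R i` and `R j`, and empty the query list -/
  | ask (i j : ℕ)
  /-- stop with the answer `b` -/
  | halt (b : Bool)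

/-- A program is a finite list of instructions. -/
abbrev Program := List Instr

/-- An oracle maps query lists to nonnegative rational numbers. -/
abbrev Oracle := List ℕ → NNRat

/-- A configuration of the machine; `answer` is `some b` once it has stopped with answer `b`. -/
structure RamCfg where
  pc : ℕ
  reg : ℕ → ℕ
  query : List ℕ
  answer : Option Bool

namespace RamCfg

/-- Set `R i := v` and pass to the next instruction. -/
def set (C : RamCfg) (i v : ℕ) : RamCfg :=
  { C with pc := C.pc + 1, reg := Function.update C.reg i v }

/-- The effect of a single instruction. -/
def exec (Ω : Oracle) (inp : List ℕ) (C : RamCfg) : Instr → RamCfg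
  | .const i v => C.set i v
  | .copy i j => C.set i (C.reg j)
  | .add i j k => C.set i (C.reg j + C.reg k)
  | .sub i j k => C.set i (C.reg j - C.reg k)
  | .half i j => C.set i (C.reg j / 2)
  | .load i j => C.set i (C.reg (C.reg j))
  | .store i j => C.set (C.reg i) (C.reg j)
  | .inputLength i => C.set i inp.length
  | .input i j => C.set i (inp.getD (C.reg j) 0)
  | .jump l => { C with pc := l }
  | .jumpZero i l => { C with pc := if C.reg i = 0 then l else C.pc + 1 }
  | .emit i => { C with pc := C.pc + 1, query := C.query ++ [C.reg i] }
  | .ask i j =>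
      { C with
        pc := C.pc + 1
        reg := Function.update (Function.update C.reg i (Ω C.query).num) j (Ω C.query).den
        query := [] }
  | .halt b => { C with answer := some b }

/-- One step of program `P`. A stopped machine does not move, nor does one whose program counter
is outside of the program. -/
def step (P : Program) (Ω : Oracle) (inp : List ℕ) (C : RamCfg) : RamCfg :=
  match C.answer, P[C.pc]? with
  | none, some I => C.exec Ω inp I
  | _, _ => C

end RamCfg

namespace Program

/-- The configuration of program `P` with oracle `Ω` on input `inp` after `t` steps. -/
def run (P : Program) (Ω : Oracle) (inp : List ℕ) (t : ℕ) : RamCfg :=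
  (RamCfg.step P Ω inp)^[t] ⟨0, fun _ => 0, [], none⟩

/-- On input `inp`, the program stops within `T` steps, answering whether `φ` holds. -/
def DecidesWithin (P : Program) (Ω : Oracle) (inp : List ℕ) (T : ℕ) (φ : Prop) : Prop :=
  ∃ t ≤ T, ∃ b : Bool, (P.run Ω inp t).answer = some b ∧ (b = true ↔ φ)

/-- The query list `w` is submitted to the oracle at some time of the run on input `inp`. -/
def Queries (P : Program) (Ω : Oracle) (inp w : List ℕ) : Prop :=
  ∃ t i j, P[(P.run Ω inp t).pc]? = some (Instr.ask i j) ∧ (P.run Ω inp t).query = w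

end Program

/-! ### Problems and reductions -/

/-- A parameterised decision problem, with the presentation of its instances to a machine. -/
structure DecisionProblem where
  Inst : Type
  enc : Inst → List ℕ
  param : Inst → ℕ
  holds : Inst → Prop

/-- A parameterised numerical problem: given an instance `x`, output any number `z` with
`sol x z`. -/
structure NumberProblem where
  Inst : Type
  enc : Inst → List ℕ
  param : Inst → ℕ
  sol : Inst → NNRat → Prop

/-- `Ω` is an oracle for `F`: each instance is given some correct answer. Nothing is required of
the answers to lists that present no instance. -/
def NumberProblem.IsSolvedBy (F : NumberProblem) (Ω : Oracle) : Prop :=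
  ∀ y : F.Inst, F.sol y (Ω (F.enc y))

/-- The size of an input in bits, with one separator for each entry. -/
def inputSize (w : List ℕ) : ℕ := (w.map fun v => Nat.size v + 1).sum

/-- A polynomial-time Turing reduction from the language `L` to `F`. The reduction has to work with
every oracle for `F`. -/
def PolyTimeTuringReducible (L : Set (List Bool)) (F : NumberProblem) : Prop :=
  ∃ (P : Program) (p : Polynomial ℕ), ∀ Ω : Oracle, F.IsSolvedBy Ω → ∀ x : List Bool,
    P.DecidesWithin Ω (x.map Bool.toNat) (p.eval x.length) (x ∈ L) ∧
    ∀ w, P.Queries Ω (x.map Bool.toNat) w → ∃ y : F.Inst, w = F.enc y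

/-- `F` is NP-hard: each language in NP has a polynomial-time Turing reduction to `F`. -/
def NPHard (F : NumberProblem) : Prop :=
  ∀ L : Set (List Bool), InNP L → PolyTimeTuringReducible L F

/-- An FPT Turing reduction from `D` to `F`: with every oracle for `F`, each instance `x` with
parameter `k` is decided in time `f k * |x| ^ d`, and all queries are instances of `F` with
parameter at most `g k`. -/
def FPTTuringReducible (D : DecisionProblem) (F : NumberProblem) : Prop :=
  ∃ (P : Program) (f g : ℕ → ℕ) (d : ℕ), Computable f ∧ Computable g ∧
    ∀ Ω : Oracle, F.IsSolvedBy Ω → ∀ x : D.Inst,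
      P.DecidesWithin Ω (D.enc x) (f (D.param x) * inputSize (D.enc x) ^ d) (D.holds x) ∧
      ∀ w, P.Queries Ω (D.enc x) w → ∃ y : F.Inst, w = F.enc y ∧ F.param y ≤ g (D.param x)

/-! ### Cliques and W[1]-hardness -/

/-- An instance of the clique problem: a graph and a positive integer. -/
structure CliqueInst where
  n : ℕ
  G : SimpleGraph (Fin n)
  k : ℕ
  k_pos : 0 < k

open Classical in
/-- The number of vertices, `k`, and the adjacency matrix, row by row. -/
noncomputable def CliqueInst.enc (x : CliqueInst) : List ℕ :=
  x.n :: x.k :: (List.finRange x.n).flatMap fun i =>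
    (List.finRange x.n).map fun j => if x.G.Adj i j then 1 else 0

/-- Does the graph contain a `k`-clique? The parameter is `k`. -/
noncomputable def cliqueProblem : DecisionProblem where
  Inst := CliqueInst
  enc := CliqueInst.enc
  param x := x.k
  holds x := ∃ s : Finset (Fin x.n), x.G.IsNClique x.k s

/-- `F` is W[1]-hard: the clique problem has an FPT Turing reduction to `F`. -/
def W1Hard (F : NumberProblem) : Prop :=
  FPTTuringReducible cliqueProblem F

/-! ### Counting independent sets of bipartite graphs -/

/-- A nonempty bipartite graph `(U, V, E)` with `U = Fin a`, `V = Fin b` and `E ⊆ U × V`. -/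
structure BipGraph where
  a : ℕ
  b : ℕ
  E : Set (Fin a × Fin b)
  nonempty : 0 < a + b

namespace BipGraph

/-- The underlying graph on the disjoint union of `U` and `V`. -/
def graph (G : BipGraph) : SimpleGraph (Fin G.a ⊕ Fin G.b) :=
  SimpleGraph.fromRel fun x y => ∃ u v, x = Sum.inl u ∧ y = Sum.inr v ∧ (u, v) ∈ G.E

/-- The number of vertices. -/
def order (G : BipGraph) : ℕ := G.a + G.b

open Classical in
/-- The number of `ℓ`-left independent sets: independent sets with exactly `ℓ` vertices in `U`. -/
noncomputable def leftIS (G : BipGraph) (ℓ : ℕ) : ℕ :=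
  (Finset.univ.filter fun S : Finset (Fin G.a ⊕ Fin G.b) =>
    G.graph.IsIndepSet (S : Set (Fin G.a ⊕ Fin G.b)) ∧ S.toLeft.card = ℓ).card

open Classical in
/-- `|U|`, `|V|`, `ℓ`, and the biadjacency matrix, row by row. -/
noncomputable def enc (G : BipGraph) (ℓ : ℕ) : List ℕ :=
  G.a :: G.b :: ℓ :: (List.finRange G.a).flatMap fun u =>
    (List.finRange G.b).map fun v => if (u, v) ∈ G.E then 1 else 0

end BipGraph

/-- Given a bipartite graph `G` on `n` vertices and `ℓ`, output a number `z` that approximates the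
number of `ℓ`-left independent sets of `G` within the factor `n ^ c`. The parameter is `ℓ`. -/
noncomputable def approxLeftIS (c : ℝ) : NumberProblem where
  Inst := BipGraph × ℕ
  enc y := y.1.enc y.2
  param y := y.2
  sol y z :=
    (y.1.order : ℝ) ^ (-c) * (y.1.leftIS y.2 : ℝ) ≤ (z : ℝ) ∧
    (z : ℝ) ≤ (y.1.order : ℝ) ^ c * (y.1.leftIS y.2 : ℝ)

/-! Both hardness results come from one gap construction. Let `R` be a relation on the numbers below
`N`, and ask for a set of `K` numbers that are all related to each other and to themselves. The left
vertices of the gadget are the pairs of numbers, the right vertices are `t` copies of each number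
below `N + K + 1`, and `ℓ = K * K`. A clique set `S` yields the `K * K` left vertices `S ×ˢ S`,
which block only the copies of `K` numbers, so there are at least `2 ^ (t * (N + 1))` left
independent sets (`le_leftIS_gadget`). Without a clique set, any `K * K` pairs in `R` mention at
least `K + 1` numbers, since with only `K` numbers they would be all pairs over a clique set; a pair
outside `R` blocks everything. So at most `t * N` right vertices stay free, and the count is at most
`2 ^ (N * N) * 2 ^ (t * N)` (`leftIS_gadget_le`). The `K + 1` surplus blocks on the right keep this
gap intact even when `K` is close to `N` or above it.

With `t = N * N + 2 * s` the two bounds differ by a factor `2 ^ (2 * s)`. If `s` is a large constant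
times `N + K + 1`, then `n ^ c < 2 ^ s`, and one approximate answer, compared with a power of two,
decides the clique question (`hasCliqueSet_iff`).

For W[1]-hardness, `R` is adjacency or equality, and `ℓ = k * k` depends on the parameter only. For
NP-hardness, the numbers encode entries of a computation trace: time, head position, time after the
last visit of that position, next move. Storing the last visit turns correctness of a trace into a
condition on pairs of entries (`NTM.Compat`), so accepting computations correspond to cliques of
size `T + 1`.

To obtain actual programs, `N`, `K` and `R` are described by arithmetic expressions with bounded
sums. These compile to machine code that runs in time polynomial in `magnitude`, and
`exists_reduction` combines such a description with the gadget once and for all. -/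

/-! ### Structured code for the random access machine -/

/-- The instructions that only act on registers and the query list and then pass on. -/
def Instr.IsBasic : Instr → Prop
  | .jump _ | .jumpZero _ _ | .ask _ _ | .halt _ => False
  | _ => True

/-- `Reach P Ω inp C n D`: in `n` steps, none of which asks the oracle, `P` passes from `C` to `D`. -/
inductive Reach (P : Program) (Ω : Oracle) (inp : List ℕ) : RamCfg → ℕ → RamCfg → Prop
  | refl (C : RamCfg) : Reach P Ω inp C 0 C
  | step {C D : RamCfg} {n : ℕ} {I : Instr} : C.answer = none → P[C.pc]? = some I →
      (∀ i j, I ≠ .ask i j) → Reach P Ω inp (C.exec Ω inp I) n D → Reach P Ω inp C (n + 1) D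

theorem Reach.trans {P : Program} {Ω : Oracle} {inp : List ℕ} {C D E : RamCfg} {m n : ℕ}
    (h : Reach P Ω inp C m D) (h' : Reach P Ω inp D n E) : Reach P Ω inp C (m + n) E := by
  induction h with
  | refl C => simpa using h'
  | step h1 h2 h3 _ ih =>
    rw [Nat.add_right_comm]
    exact .step h1 h2 h3 (ih h')

theorem RamCfg.step_eq {P : Program} {Ω : Oracle} {inp : List ℕ} {C : RamCfg} {I : Instr}
    (h1 : C.answer = none) (h2 : P[C.pc]? = some I) : RamCfg.step P Ω inp C = C.exec Ω inp I := by
  simp [RamCfg.step, h1, h2]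

theorem Reach.iterate {P : Program} {Ω : Oracle} {inp : List ℕ} {C D : RamCfg} {n : ℕ}
    (h : Reach P Ω inp C n D) : (RamCfg.step P Ω inp)^[n] C = D := by
  induction h with
  | refl C => rfl
  | step h1 h2 _ _ ih => rw [Function.iterate_succ_apply, RamCfg.step_eq h1 h2, ih]

/-- Excludes further queries before and after the single intended one in `exists_program`. -/
theorem Reach.not_ask {P : Program} {Ω : Oracle} {inp : List ℕ} {C D : RamCfg} {n : ℕ}
    (h : Reach P Ω inp C n D) :
    ∀ t < n, ∀ i j, P[((RamCfg.step P Ω inp)^[t] C).pc]? ≠ some (.ask i j) := by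
  induction h with
  | refl C => intro t ht; omega
  | step h1 h2 h3 _ ih =>
    intro t ht i j
    cases t with
    | zero => simpa [h2] using h3 i j
    | succ t =>
      rw [Function.iterate_succ_apply, RamCfg.step_eq h1 h2]
      exact ih t (by omega) i j

/-- The instructions `c` stand in `P` from position `off` on. -/
def CodeAt (P : Program) : ℕ → List Instr → Prop
  | _, [] => True
  | off, I :: c => P[off]? = some I ∧ CodeAt P (off + 1) c

theorem codeAt_append {P : Program} {c d : List Instr} : ∀ {off : ℕ},
    CodeAt P off (c ++ d) ↔ CodeAt P off c ∧ CodeAt P (off + c.length) d := by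
  induction c with
  | nil => simp [CodeAt]
  | cons I c ih =>
    intro off
    simp only [List.cons_append, CodeAt, ih, List.length_cons, and_assoc]
    rw [show off + 1 + c.length = off + (c.length + 1) by omega]

theorem codeAt_self (c pre : List Instr) : CodeAt (pre ++ c) pre.length c := by
  induction c generalizing pre with
  | nil => trivial
  | cons I c ih =>
    refine ⟨by simp, ?_⟩
    simpa using ih (pre ++ [I])

/-- Relocatable code: a list of instructions for each position. -/
abbrev Code := ℕ → List Instr

namespace Code

/-- One instruction. -/
def instr (I : Instr) : Code := fun _ => [I]

/-- Sequential composition. -/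
def seq (c d : Code) : Code := fun off => c off ++ d (off + (c off).length)

/-- Repeat `c` while `R r ≠ 0`. -/
def loop (r : ℕ) (c : Code) : Code := fun off =>
  Instr.jumpZero r (off + 1 + (c (off + 1)).length + 1) :: (c (off + 1) ++ [Instr.jump off])

/-- Started with registers `reg` and query list `q`, the code `c` runs for `n` steps and leaves
registers `reg'` and query list `q'`. -/
def Exec (Ω : Oracle) (inp : List ℕ) (c : Code) (reg : ℕ → ℕ) (q : List ℕ) (n : ℕ)
    (reg' : ℕ → ℕ) (q' : List ℕ) : Prop :=
  ∀ P off, CodeAt P off (c off) →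
    Reach P Ω inp ⟨off, reg, q, none⟩ n ⟨off + (c off).length, reg', q', none⟩

variable {Ω : Oracle} {inp : List ℕ} {c d : Code} {reg reg' reg'' : ℕ → ℕ} {q q' q'' : List ℕ}
  {n n' : ℕ}

theorem Exec.seq (h : Exec Ω inp c reg q n reg' q') (h' : Exec Ω inp d reg' q' n' reg'' q'') :
    Exec Ω inp (c.seq d) reg q (n + n') reg'' q'' := by
  intro P off hP
  obtain ⟨h1, h2⟩ := codeAt_append.1 hP
  have := (h P off h1).trans (h' P _ h2)
  simpa [Code.seq, add_assoc] using this

theorem exec_instr (Ω : Oracle) (inp : List ℕ) (reg : ℕ → ℕ) (q : List ℕ) {I : Instr}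
    (hI : I.IsBasic) :
    Exec Ω inp (instr I) reg q 1 (RamCfg.exec Ω inp ⟨0, reg, q, none⟩ I).reg
      (RamCfg.exec Ω inp ⟨0, reg, q, none⟩ I).query := by
  intro P off hP
  refine Reach.step rfl hP.1 ?_ ?_
  · rintro i j rfl
    exact hI
  · cases I <;> first | exact hI.elim | exact Reach.refl _

theorem exec_loop_zero {r : ℕ} (h : reg r = 0) : Exec Ω inp (loop r c) reg q 1 reg q := by
  intro P off hP
  refine Reach.step rfl hP.1 (by simp) ?_
  have : RamCfg.exec Ω inp ⟨off, reg, q, none⟩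
      (.jumpZero r (off + 1 + (c (off + 1)).length + 1)) =
        ⟨off + (loop r c off).length, reg, q, none⟩ := by
    simp [RamCfg.exec, h, loop]; omega
  rw [this]
  exact Reach.refl _

theorem exec_loop_ne_zero {r : ℕ} (h : reg r ≠ 0) (hc : Exec Ω inp c reg q n reg' q')
    (hl : Exec Ω inp (loop r c) reg' q' n' reg'' q'') :
    Exec Ω inp (loop r c) reg q (n + n' + 2) reg'' q'' := by
  intro P off hP
  obtain ⟨h1, h2⟩ := hP
  obtain ⟨h2, h3⟩ := codeAt_append.1 h2
  rw [show n + n' + 2 = (n + (n' + 1)) + 1 by omega]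
  refine Reach.step rfl h1 (by simp) ?_
  have : RamCfg.exec Ω inp ⟨off, reg, q, none⟩
      (.jumpZero r (off + 1 + (c (off + 1)).length + 1)) = ⟨off + 1, reg, q, none⟩ := by
    simp [RamCfg.exec, h]
  rw [this]
  refine (hc P _ h2).trans ?_
  refine Reach.step (I := .jump off) rfl h3.1 (by simp) ?_
  exact hl P off ⟨h1, codeAt_append.2 ⟨h2, h3⟩⟩

end Code

/-! ### Arithmetic expressions with bounded sums -/

/-- The environment that assigns `i` to the first variable and shifts `v`. -/
def push (i : ℕ) (v : ℕ → ℕ) : ℕ → ℕ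
  | 0 => i
  | n + 1 => v n

/-- Arithmetic expressions over an input list, with de Bruijn variables; `sum a b` is the sum of
`b` over all values less than `a` of a new first variable. -/
inductive NatExpr where
  | var (n : ℕ)
  | const (k : ℕ)
  | len
  | entry (a : NatExpr)
  | add (a b : NatExpr)
  | sub (a b : NatExpr)
  | sum (a b : NatExpr)

namespace NatExpr

/-- The value of an expression. -/
def eval (inp : List ℕ) : NatExpr → (ℕ → ℕ) → ℕ
  | var n, v => v n
  | const k, _ => k
  | len, _ => inp.length
  | entry a, v => inp.getD (a.eval inp v) 0
  | add a b, v => a.eval inp v + b.eval inp v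
  | sub a b, v => a.eval inp v - b.eval inp v
  | sum a b, v => ∑ i ∈ Finset.range (a.eval inp v), b.eval inp (push i v)

/-- The time that the compiled expression takes. -/
def cost (inp : List ℕ) : NatExpr → (ℕ → ℕ) → ℕ
  | var _, _ => 1
  | const _, _ => 1
  | len, _ => 1
  | entry a, v => a.cost inp v + 1
  | add a b, v => a.cost inp v + b.cost inp v + 1
  | sub a b, v => a.cost inp v + b.cost inp v + 1
  | sum a b, v => a.cost inp v + 3 +
      (∑ i ∈ Finset.range (a.eval inp v), (b.cost inp (push i v) + 5) + 1)

/-- Code that puts the value of an expression into register `m`, using no registers below `m`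
but those `ρ n` that hold the variables. -/
def compile : NatExpr → ℕ → (ℕ → ℕ) → Code
  | var n, m, ρ => .instr (.copy m (ρ n))
  | const k, m, _ => .instr (.const m k)
  | len, m, _ => .instr (.inputLength m)
  | entry a, m, ρ => (a.compile m ρ).seq (.instr (.input m m))
  | add a b, m, ρ => ((a.compile m ρ).seq (b.compile (m + 1) ρ)).seq (.instr (.add m m (m + 1)))
  | sub a b, m, ρ => ((a.compile m ρ).seq (b.compile (m + 1) ρ)).seq (.instr (.sub m m (m + 1)))
  | sum a b, m, ρ =>
    ((a.compile (m + 1) ρ).seq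
      (((Code.instr (.const m 0)).seq (.instr (.const (m + 2) 0))).seq
        (.instr (.const (m + 3) 1)))).seq
    (.loop (m + 1) ((b.compile (m + 4) (push (m + 2) ρ)).seq
      (((Code.instr (.add m m (m + 4))).seq (.instr (.add (m + 2) (m + 2) (m + 3)))).seq
        (.instr (.sub (m + 1) (m + 1) (m + 3))))))

open Code

/-- Registers work as a stack: everything below `m` is preserved, and the variables live there, so a
second operand can be evaluated from a higher base without destroying the first. A sum uses `m` as
accumulator, `m + 1` as countdown, `m + 2` as summation variable and `m + 3` for the constant 1; its
body starts at `m + 4`. -/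
theorem exec_compile (Ω : Oracle) (inp : List ℕ) (e : NatExpr) :
    ∀ (m : ℕ) (ρ : ℕ → ℕ) (reg : ℕ → ℕ) (q : List ℕ) (v : ℕ → ℕ),
      (∀ n, ρ n < m ∧ reg (ρ n) = v n) →
      ∃ reg', Exec Ω inp (e.compile m ρ) reg q (e.cost inp v) reg' q ∧
        reg' m = e.eval inp v ∧ ∀ r < m, reg' r = reg r := by
  have upd : ∀ (f : ℕ → ℕ) (i x r : ℕ), r < i → Function.update f i x r = f r :=
    fun f i x r h => Function.update_of_ne (by omega) _ _
  have lift : ∀ {m m' : ℕ} {ρ reg reg' v : ℕ → ℕ}, (∀ n, ρ n < m ∧ reg (ρ n) = v n) → m ≤ m' →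
      (∀ r < m, reg' r = reg r) → ∀ n, ρ n < m' ∧ reg' (ρ n) = v n := by
    intro m m' ρ reg reg' v h hm hr n
    exact ⟨by have := (h n).1; omega, by rw [hr _ (h n).1, (h n).2]⟩
  induction e with
  | var n =>
    intro m ρ reg q v h
    exact ⟨_, exec_instr _ _ _ _ (by trivial), by simp [RamCfg.exec, RamCfg.set, eval, (h n).2], upd _ _ _⟩
  | const k =>
    intro m ρ reg q v h
    exact ⟨_, exec_instr _ _ _ _ (by trivial), by simp [RamCfg.exec, RamCfg.set, eval], upd _ _ _⟩
  | len =>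
    intro m ρ reg q v h
    exact ⟨_, exec_instr _ _ _ _ (by trivial), by simp [RamCfg.exec, RamCfg.set, eval], upd _ _ _⟩
  | entry a iha =>
    intro m ρ reg q v h
    obtain ⟨r1, h1, h1', h1''⟩ := iha m ρ reg q v h
    refine ⟨_, h1.seq (exec_instr _ _ _ _ (by trivial)), by simp [RamCfg.exec, RamCfg.set, eval, h1'], fun r hr => ?_⟩
    simp only [RamCfg.exec, RamCfg.set]
    rw [upd _ _ _ _ hr, h1'' r hr]
  | add a b iha ihb =>
    intro m ρ reg q v h
    obtain ⟨r1, h1, h1', h1''⟩ := iha m ρ reg q v h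
    obtain ⟨r2, h2, h2', h2''⟩ := ihb (m + 1) ρ r1 q v (lift h (by omega) h1'')
    refine ⟨_, (h1.seq h2).seq (exec_instr _ _ _ _ (by trivial)), ?_, fun r hr => ?_⟩
    · simp [RamCfg.exec, RamCfg.set, eval, h2', h2'' m (by omega), h1']
    · simp only [RamCfg.exec, RamCfg.set]
      rw [upd _ _ _ _ hr, h2'' r (by omega), h1'' r hr]
  | sub a b iha ihb =>
    intro m ρ reg q v h
    obtain ⟨r1, h1, h1', h1''⟩ := iha m ρ reg q v h
    obtain ⟨r2, h2, h2', h2''⟩ := ihb (m + 1) ρ r1 q v (lift h (by omega) h1'')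
    refine ⟨_, (h1.seq h2).seq (exec_instr _ _ _ _ (by trivial)), ?_, fun r hr => ?_⟩
    · simp [RamCfg.exec, RamCfg.set, eval, h2', h2'' m (by omega), h1']
    · simp only [RamCfg.exec, RamCfg.set]
      rw [upd _ _ _ _ hr, h2'' r (by omega), h1'' r hr]
  | sum a b iha ihb =>
    intro m ρ reg q v h
    obtain ⟨r1, h1, h1', h1''⟩ := iha (m + 1) ρ reg q v (lift h (by omega) fun _ _ => rfl)
    -- Induction on the number `k` of remaining rounds, for every current value `i` of the summation
    -- variable and every accumulator.
    have key : ∀ k i (reg1 : ℕ → ℕ), reg1 (m + 1) = k → reg1 (m + 2) = i → reg1 (m + 3) = 1 →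
        (∀ r < m, reg1 r = reg r) →
        ∃ reg', Exec Ω inp (.loop (m + 1) ((b.compile (m + 4) (push (m + 2) ρ)).seq
          (((Code.instr (.add m m (m + 4))).seq (.instr (.add (m + 2) (m + 2) (m + 3)))).seq
            (.instr (.sub (m + 1) (m + 1) (m + 3)))))) reg1 q
            (∑ j ∈ Finset.range k, (b.cost inp (push (i + j) v) + 5) + 1) reg' q ∧
          reg' m = reg1 m + ∑ j ∈ Finset.range k, b.eval inp (push (i + j) v) ∧
          ∀ r < m, reg' r = reg r := by
      intro k
      induction k with
      | zero =>
        intro i reg1 hk hi h3 hr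
        exact ⟨reg1, by simpa using exec_loop_zero hk, by simp, hr⟩
      | succ k ih =>
        intro i reg1 hk hi h3 hr
        obtain ⟨r2, h2, h2', h2''⟩ := ihb (m + 4) (push (m + 2) ρ) reg1 q (push i v) (by
          intro n
          cases n with
          | zero => exact ⟨by simp [push], by simp [push, hi]⟩
          | succ n => exact lift h (by omega) hr n)
        have e1 := h2'' (m + 1) (by omega)
        have e2 := h2'' (m + 2) (by omega)
        have e3 := h2'' (m + 3) (by omega)
        obtain ⟨r4, hbody, p0, p1, p2, p3, pr⟩ : ∃ r4, Exec Ω inp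
            ((b.compile (m + 4) (push (m + 2) ρ)).seq
              (((Code.instr (.add m m (m + 4))).seq (.instr (.add (m + 2) (m + 2) (m + 3)))).seq
                (.instr (.sub (m + 1) (m + 1) (m + 3))))) reg1 q
              (b.cost inp (push i v) + 3) r4 q ∧ r4 m = r2 m + r2 (m + 4) ∧ r4 (m + 1) = k ∧
            r4 (m + 2) = i + 1 ∧ r4 (m + 3) = 1 ∧ ∀ r < m, r4 r = r2 r := by
          refine ⟨_, h2.seq (((exec_instr _ _ _ _ (by trivial)).seq (exec_instr _ _ _ _ (by trivial))).seq
            (exec_instr _ _ _ _ (by trivial))), ?_, ?_, ?_, ?_, fun r hr => ?_⟩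
          · simp [RamCfg.exec, RamCfg.set]
          · simp [RamCfg.exec, RamCfg.set, e1, e3, hk, h3]
          · simp [RamCfg.exec, RamCfg.set, e2, e3, hi, h3]
          · simp [RamCfg.exec, RamCfg.set, e3, h3]
          · simp only [RamCfg.exec, RamCfg.set]
            rw [upd _ _ _ _ (by omega), upd _ _ _ _ (by omega), upd _ _ _ _ hr]
        obtain ⟨r3, h3a, h3b, h3c⟩ := ih (i + 1) r4 p1 p2 p3 fun r hr' => by
          rw [pr r hr', h2'' r (by omega), hr r hr']
        refine ⟨r3, ?_, ?_, h3c⟩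
        · have := exec_loop_ne_zero (r := m + 1) (by omega) hbody h3a
          convert this using 1
          rw [Finset.sum_range_succ']
          simp only [add_zero, add_assoc, add_comm 1]
          omega
        · rw [h3b, Finset.sum_range_succ']
          simp only [p0, h2'' m (by omega), h2', add_assoc, add_comm 1, add_zero]
          omega
    obtain ⟨r4, hpre, p0, p1, p2, p3, pr⟩ : ∃ r4, Exec Ω inp ((a.compile (m + 1) ρ).seq
          (((Code.instr (.const m 0)).seq (.instr (.const (m + 2) 0))).seq
            (.instr (.const (m + 3) 1)))) reg q (a.cost inp v + 3) r4 q ∧ r4 m = 0 ∧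
          r4 (m + 1) = a.eval inp v ∧ r4 (m + 2) = 0 ∧ r4 (m + 3) = 1 ∧ ∀ r < m, r4 r = r1 r := by
      refine ⟨_, h1.seq (((exec_instr _ _ _ _ (by trivial)).seq (exec_instr _ _ _ _ (by trivial))).seq
        (exec_instr _ _ _ _ (by trivial))), ?_, ?_, ?_, ?_, fun r hr => ?_⟩
      · simp [RamCfg.exec, RamCfg.set]
      · simp [RamCfg.exec, RamCfg.set, h1']
      · simp [RamCfg.exec, RamCfg.set]
      · simp [RamCfg.exec, RamCfg.set]
      · simp only [RamCfg.exec, RamCfg.set]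
        rw [upd _ _ _ _ (by omega), upd _ _ _ _ (by omega), upd _ _ _ _ hr]
    obtain ⟨r2, h2, h2', h2''⟩ := key (a.eval inp v) 0 r4 p1 p2 p3 fun r hr => by
      rw [pr r hr, h1'' r (by omega)]
    refine ⟨r2, ?_, ?_, h2''⟩
    · simpa [cost, compile] using hpre.seq h2
    · simp [h2', p0, eval]

end NatExpr

/-! ### Polynomial bounds -/

theorem polynomial_eval_mono (p : Polynomial ℕ) : Monotone fun n => p.eval n := by
  intro a b h
  simp only [Polynomial.eval_eq_sum_range]
  exact Finset.sum_le_sum fun i _ => Nat.mul_le_mul_left _ (Nat.pow_le_pow_left h i)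

/-- The length of a list plus the sum of its entries. -/
def magnitude (inp : List ℕ) : ℕ := inp.length + inp.sum

theorem getD_le_magnitude (inp : List ℕ) (i : ℕ) : inp.getD i 0 ≤ magnitude inp := by
  rw [List.getD_eq_getElem?_getD]
  by_cases h : i < inp.length
  · simp only [List.getElem?_eq_getElem h, Option.getD_some]
    exact (List.single_le_sum (by simp) _ (List.getElem_mem h)).trans (Nat.le_add_left _ _)
  · simp [List.getElem?_eq_none (not_lt.1 h)]

/-- The bound `B` covers the variables as well as the input, so that the induction can pass under
the binder of a sum. -/
theorem NatExpr.exists_polynomial_bound (e : NatExpr) : ∃ p : Polynomial ℕ,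
    ∀ (inp : List ℕ) (v : ℕ → ℕ) (B : ℕ), magnitude inp ≤ B → (∀ n, v n ≤ B) →
      e.eval inp v ≤ p.eval B ∧ e.cost inp v ≤ p.eval B := by
  induction e with
  | var n =>
    refine ⟨.X + 1, fun inp v B _ hv => ?_⟩
    have := hv n
    simp only [eval, cost, Polynomial.eval_add, Polynomial.eval_X, Polynomial.eval_one]
    omega
  | const k =>
    refine ⟨.C k + 1, fun inp v B _ hv => ?_⟩
    simp only [eval, cost, Polynomial.eval_add, Polynomial.eval_C, Polynomial.eval_one]
    omega
  | len =>
    refine ⟨.X + 1, fun inp v B hB hv => ?_⟩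
    simp only [magnitude] at hB
    simp only [eval, cost, Polynomial.eval_add, Polynomial.eval_X, Polynomial.eval_one]
    omega
  | entry a iha =>
    obtain ⟨p, hp⟩ := iha
    refine ⟨.X + p + 1, fun inp v B hB hv => ?_⟩
    have h1 := hp inp v B hB hv
    have h2 := getD_le_magnitude inp (a.eval inp v)
    simp only [eval, cost, Polynomial.eval_add, Polynomial.eval_X, Polynomial.eval_one]
    omega
  | add a b iha ihb =>
    obtain ⟨p, hp⟩ := iha
    obtain ⟨q, hq⟩ := ihb
    refine ⟨p + q + 1, fun inp v B hB hv => ?_⟩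
    have h1 := hp inp v B hB hv
    have h2 := hq inp v B hB hv
    simp only [eval, cost, Polynomial.eval_add, Polynomial.eval_one]
    omega
  | sub a b iha ihb =>
    obtain ⟨p, hp⟩ := iha
    obtain ⟨q, hq⟩ := ihb
    refine ⟨p + q + 1, fun inp v B hB hv => ?_⟩
    have h1 := hp inp v B hB hv
    have h2 := hq inp v B hB hv
    simp only [eval, cost, Polynomial.eval_add, Polynomial.eval_one]
    omega
  | sum a b iha ihb =>
    obtain ⟨p, hp⟩ := iha
    obtain ⟨q, hq⟩ := ihb
    -- The summation variable is less than `p.eval B`, so `B + p.eval B` bounds the extended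
    -- environment; there are at most `p.eval B` rounds.
    refine ⟨p + 4 + p * (q.comp (.X + p) + 5), fun inp v B hB hv => ?_⟩
    have h1 := hp inp v B hB hv
    have h2 : ∀ i ∈ Finset.range (a.eval inp v),
        b.eval inp (push i v) ≤ q.eval (B + p.eval B) ∧
        b.cost inp (push i v) + 5 ≤ q.eval (B + p.eval B) + 5 := by
      intro i hi
      rw [Finset.mem_range] at hi
      have := hq inp (push i v) (B + p.eval B) (by omega) (by
        rintro (_ | n)
        · simp only [push]; omega
        · have := hv n
          simp only [push]; omega)
      omega
    have h3 := Finset.sum_le_card_nsmul _ _ _ fun i hi => (h2 i hi).1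
    have h4 := Finset.sum_le_card_nsmul _ _ _ fun i hi => (h2 i hi).2
    simp only [Finset.card_range, smul_eq_mul] at h3 h4
    have h5 := Nat.mul_le_mul_right (q.eval (B + p.eval B)) h1.1
    have h6 := Nat.mul_le_mul_right (q.eval (B + p.eval B) + 5) h1.1
    simp only [eval, cost, Polynomial.eval_add, Polynomial.eval_mul, Polynomial.eval_comp,
      Polynomial.eval_X, Polynomial.eval_ofNat]
    simp only [Nat.mul_add] at h4 h6 ⊢
    omega

/-! ### A program that asks one question -/

/-- The empty environment. -/
def nullEnv : ℕ → ℕ := fun _ => 0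

namespace Code

/-- Emit the value of an expression. -/
def emitExpr (e : NatExpr) : Code := (e.compile 1 nullEnv).seq (.instr (.emit 1))

/-- Emit the values of `ent` for all values of its first variable less than the value of `cnt`. -/
def emitLoop (cnt ent : NatExpr) : Code :=
  ((cnt.compile 1 nullEnv).seq ((Code.instr (.const 2 0)).seq (.instr (.const 3 1)))).seq
  (.loop 1 ((ent.compile 4 (push 2 nullEnv)).seq
    (((Code.instr (.emit 4)).seq (.instr (.add 2 2 3))).seq (.instr (.sub 1 1 3)))))

/-- Double register `r` as many times as the value of `e`. -/
def shift (r : ℕ) (e : NatExpr) : Code :=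
  ((e.compile 4 nullEnv).seq (.instr (.const 3 1))).seq
    (.loop 4 ((Code.instr (.add r r r)).seq (.instr (.sub 4 4 3))))

/-- Register 0 is kept at zero throughout: it represents all variables of the empty environment. -/
theorem exec_emitExpr (Ω : Oracle) (inp : List ℕ) (e : NatExpr) (reg : ℕ → ℕ) (q : List ℕ)
    (h : reg 0 = 0) : ∃ reg', Exec Ω inp (emitExpr e) reg q (e.cost inp nullEnv + 1) reg'
      (q ++ [e.eval inp nullEnv]) ∧ reg' 0 = 0 := by
  obtain ⟨r1, h1, h2, h3⟩ := e.exec_compile Ω inp 1 nullEnv reg q nullEnv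
    fun n => ⟨by simp [nullEnv], by simpa [nullEnv] using h⟩
  refine ⟨r1, ?_, by rw [h3 0 (by omega), h]⟩
  have := h1.seq (exec_instr Ω inp r1 q (I := .emit 1) trivial)
  simpa [emitExpr, RamCfg.exec, h2] using this

theorem exec_emitLoop (Ω : Oracle) (inp : List ℕ) (cnt ent : NatExpr) (reg : ℕ → ℕ) (q : List ℕ)
    (h : reg 0 = 0) : ∃ reg', Exec Ω inp (emitLoop cnt ent) reg q
      (cnt.cost inp nullEnv + 2 + (∑ i ∈ Finset.range (cnt.eval inp nullEnv),
        (ent.cost inp (push i nullEnv) + 5) + 1)) reg'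
      (q ++ (List.range (cnt.eval inp nullEnv)).map fun i => ent.eval inp (push i nullEnv)) ∧
      reg' 0 = 0 := by
  have key : ∀ k i (reg1 : ℕ → ℕ) (q : List ℕ), reg1 1 = k → reg1 2 = i → reg1 3 = 1 →
      reg1 0 = 0 → ∃ reg', Exec Ω inp (.loop 1 ((ent.compile 4 (push 2 nullEnv)).seq
        (((Code.instr (.emit 4)).seq (.instr (.add 2 2 3))).seq (.instr (.sub 1 1 3))))) reg1 q
          (∑ j ∈ Finset.range k, (ent.cost inp (push (i + j) nullEnv) + 5) + 1) reg'
          (q ++ (List.range k).map fun j => ent.eval inp (push (i + j) nullEnv)) ∧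
        reg' 0 = 0 := by
    intro k
    induction k with
    | zero =>
      intro i reg1 q hk hi h3 h0
      exact ⟨reg1, by simpa using exec_loop_zero hk, h0⟩
    | succ k ih =>
      intro i reg1 q hk hi h3 h0
      obtain ⟨r2, h2, h2', h2''⟩ := ent.exec_compile Ω inp 4 (push 2 nullEnv) reg1 q
        (push i nullEnv) (by
          rintro (_ | n)
          · exact ⟨by simp [push], by simp [push, hi]⟩
          · exact ⟨by simp [push, nullEnv], by simp [push, nullEnv, h0]⟩)
      have e0 := h2'' 0 (by omega)
      have e1 := h2'' 1 (by omega)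
      have e2 := h2'' 2 (by omega)
      have e3 := h2'' 3 (by omega)
      obtain ⟨r4, hbody, p0, p1, p2, p3⟩ : ∃ r4, Exec Ω inp
          ((ent.compile 4 (push 2 nullEnv)).seq
            (((Code.instr (.emit 4)).seq (.instr (.add 2 2 3))).seq (.instr (.sub 1 1 3)))) reg1 q
            (ent.cost inp (push i nullEnv) + 3) r4 (q ++ [ent.eval inp (push i nullEnv)]) ∧
          r4 0 = 0 ∧ r4 1 = k ∧ r4 2 = i + 1 ∧ r4 3 = 1 := by
        rw [← h2']
        refine ⟨_, h2.seq (((exec_instr _ _ _ _ (by trivial)).seq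
          (exec_instr _ _ _ _ (by trivial))).seq (exec_instr _ _ _ _ (by trivial))), ?_⟩
        simp [RamCfg.exec, RamCfg.set, e0, e1, e2, e3, h0, hk, hi, h3]
      obtain ⟨r3, h3a, h3b⟩ := ih (i + 1) r4 _ p1 p2 p3 p0
      refine ⟨r3, ?_, h3b⟩
      have := exec_loop_ne_zero (r := 1) (by omega) hbody h3a
      convert this using 1
      · rw [Finset.sum_range_succ']
        simp only [add_zero, add_assoc, add_comm 1]
        omega
      · simp [List.range_succ_eq_map, add_assoc, add_comm 1, Function.comp_def]
  obtain ⟨r1, h1, h1', h1''⟩ := cnt.exec_compile Ω inp 1 nullEnv reg q nullEnv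
    fun n => ⟨by simp [nullEnv], by simpa [nullEnv] using h⟩
  obtain ⟨r4, hpre, p0, p1, p2, p3⟩ : ∃ r4, Exec Ω inp ((cnt.compile 1 nullEnv).seq
      ((Code.instr (.const 2 0)).seq (.instr (.const 3 1)))) reg q (cnt.cost inp nullEnv + 2)
        r4 q ∧ r4 0 = 0 ∧ r4 1 = cnt.eval inp nullEnv ∧ r4 2 = 0 ∧ r4 3 = 1 := by
    refine ⟨_, h1.seq ((exec_instr _ _ _ _ (by trivial)).seq
        (exec_instr _ _ _ _ (by trivial))), ?_⟩
    simp [RamCfg.exec, RamCfg.set, h1', h1'' 0, h]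
  obtain ⟨r2, h2, h2'⟩ := key _ 0 r4 q p1 p2 p3 p0
  exact ⟨r2, by simpa [emitLoop] using hpre.seq h2, h2'⟩

/-- Registers 1 and 2 hold numerator and denominator of the answer, and `3 - r` is the other one of
them. Repeated doubling multiplies by a power of two in time linear in the exponent, without a
multiplication instruction. -/
theorem exec_shift (Ω : Oracle) (inp : List ℕ) (r : ℕ) (e : NatExpr) (reg : ℕ → ℕ) (q : List ℕ)
    (h : reg 0 = 0) (hr : r = 1 ∨ r = 2) : ∃ reg', Exec Ω inp (shift r e) reg q
      (e.cost inp nullEnv + 1 + (4 * e.eval inp nullEnv + 1)) reg' q ∧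
      reg' 0 = 0 ∧ reg' r = reg r * 2 ^ e.eval inp nullEnv ∧ reg' (3 - r) = reg (3 - r) := by
  have key : ∀ k (reg1 : ℕ → ℕ), reg1 4 = k → reg1 3 = 1 → ∃ reg', Exec Ω inp
      (.loop 4 ((Code.instr (.add r r r)).seq (.instr (.sub 4 4 3)))) reg1 q (4 * k + 1) reg' q ∧
      reg' 0 = reg1 0 ∧ reg' r = reg1 r * 2 ^ k ∧ reg' (3 - r) = reg1 (3 - r) := by
    intro k
    induction k with
    | zero =>
      intro reg1 h4 h3
      exact ⟨reg1, exec_loop_zero h4, by simp⟩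
    | succ k ih =>
      intro reg1 h4 h3
      obtain ⟨r4, hbody, p0, p1, p2, p3, p4⟩ : ∃ r4, Exec Ω inp
          ((Code.instr (.add r r r)).seq (.instr (.sub 4 4 3))) reg1 q 2 r4 q ∧ r4 0 = reg1 0 ∧
          r4 r = reg1 r * 2 ∧ r4 (3 - r) = reg1 (3 - r) ∧ r4 4 = k ∧ r4 3 = 1 := by
        refine ⟨_, (exec_instr _ _ _ _ (by trivial)).seq (exec_instr _ _ _ _ (by trivial)), ?_⟩
        rcases hr with rfl | rfl <;> simp [RamCfg.exec, RamCfg.set, h3, h4, mul_two]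
      obtain ⟨r3, h3a, h3b, h3c, h3d⟩ := ih r4 p3 p4
      refine ⟨r3, ?_, by rw [h3b, p0], by rw [h3c, p1, pow_succ']; ring, by rw [h3d, p2]⟩
      have := exec_loop_ne_zero (r := 4) (by omega) hbody h3a
      convert this using 1
      omega
  obtain ⟨r1, h1, h1', h1''⟩ := e.exec_compile Ω inp 4 nullEnv reg q nullEnv
    fun n => ⟨by simp [nullEnv], by simpa [nullEnv] using h⟩
  obtain ⟨r4, hpre, p3, p4, pr⟩ : ∃ r4, Exec Ω inp ((e.compile 4 nullEnv).seq
      (.instr (.const 3 1))) reg q (e.cost inp nullEnv + 1) r4 q ∧ r4 4 = e.eval inp nullEnv ∧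
      r4 3 = 1 ∧ ∀ i < 3, r4 i = reg i := by
    refine ⟨_, h1.seq (exec_instr _ _ _ _ (by trivial)), ?_, ?_, fun i hi => ?_⟩
    · simp [RamCfg.exec, RamCfg.set, h1']
    · simp [RamCfg.exec, RamCfg.set]
    · simp only [RamCfg.exec, RamCfg.set]
      rw [Function.update_of_ne (by omega), h1'' i (by omega)]
  obtain ⟨r2, h2, h20, h2r, h2r'⟩ := key _ r4 p3 p4
  refine ⟨r2, by simpa [shift] using hpre.seq h2, by rw [h20, pr 0 (by omega), h],
    by rw [h2r, pr r (by omega)], by rw [h2r', pr _ (by omega)]⟩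

end Code

-- The query depends on the input alone and is asked once; the answer is then compared with a power
-- of two by scaling its numerator and denominator.
open Code in
theorem exists_program (a b l cnt ent s₁ s₂ : NatExpr) : ∃ (P : Program) (p : Polynomial ℕ),
    ∀ (Ω : Oracle) (inp w : List ℕ),
      w = a.eval inp nullEnv :: b.eval inp nullEnv :: l.eval inp nullEnv ::
        (List.range (cnt.eval inp nullEnv)).map (fun i => ent.eval inp (push i nullEnv)) →
      P.DecidesWithin Ω inp (p.eval (magnitude inp))
        ((Ω w).den * 2 ^ s₂.eval inp nullEnv ≤ (Ω w).num * 2 ^ s₁.eval inp nullEnv) ∧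
      ∀ w', P.Queries Ω inp w' → w' = w := by
  set main : Code := ((emitExpr a).seq ((emitExpr b).seq (emitExpr l))).seq (emitLoop cnt ent)
    with hmain
  set post : Code := ((shift 1 s₁).seq (shift 2 s₂)).seq (.instr (.sub 4 2 1)) with hpost
  -- The query is asked at position `o`; the final test is at `o'`, followed by the rejecting and
  -- the accepting halt.
  set o := (main 0).length with ho
  set o' := o + 1 + (post (o + 1)).length with ho'
  set P : Program := main 0 ++ ((Instr.ask 1 2 :: post (o + 1)) ++
    [.jumpZero 4 (o' + 2), .halt false, .halt true]) with hP
  obtain ⟨pa, hpa⟩ := a.exists_polynomial_bound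
  obtain ⟨pb, hpb⟩ := b.exists_polynomial_bound
  obtain ⟨pl, hpl⟩ := l.exists_polynomial_bound
  obtain ⟨pc, hpc⟩ := (NatExpr.sum cnt ent).exists_polynomial_bound
  obtain ⟨p1, hp1⟩ := s₁.exists_polynomial_bound
  obtain ⟨p2, hp2⟩ := s₂.exists_polynomial_bound
  refine ⟨P, pa + pb + pl + pc + 5 * p1 + 5 * p2 + 20, fun Ω inp w hw => ?_⟩
  have hcode : CodeAt P 0 P := codeAt_self P []
  nth_rw 2 [hP] at hcode
  obtain ⟨hc1, hc2⟩ := codeAt_append.1 hcode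
  obtain ⟨hc2, hc3⟩ := codeAt_append.1 hc2
  obtain ⟨hask, hc2⟩ := hc2
  rw [zero_add, ← ho] at hask hc2
  simp only [zero_add, ← ho, List.length_cons] at hc3
  rw [show o + ((post (o + 1)).length + 1) = o' by omega] at hc3
  obtain ⟨hjz, hhf, hht, -⟩ := hc3
  obtain ⟨r1, h1, h1'⟩ := exec_emitExpr Ω inp a (fun _ => 0) [] rfl
  obtain ⟨r2, h2, h2'⟩ := exec_emitExpr Ω inp b r1 _ h1'
  obtain ⟨r3, h3, h3'⟩ := exec_emitExpr Ω inp l r2 _ h2'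
  obtain ⟨r4, h4, h4'⟩ := exec_emitLoop Ω inp cnt ent r3 _ h3'
  have hm := ((h1.seq (h2.seq h3)).seq h4) P 0 hc1
  set n₁ := a.cost inp nullEnv + 1 + (b.cost inp nullEnv + 1 + (l.cost inp nullEnv + 1)) +
    (cnt.cost inp nullEnv + 2 + (∑ i ∈ Finset.range (cnt.eval inp nullEnv),
        (ent.cost inp (push i nullEnv) + 5) + 1)) with hn₁
  have hm' : Reach P Ω inp ⟨0, fun _ => 0, [], none⟩ n₁ ⟨o, r4, w, none⟩ := by
    rw [hw]
    simpa using hm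
  set r5 := Function.update (Function.update r4 1 (Ω w).num) 2 (Ω w).den with hr5
  obtain ⟨r6, h6, h6', h6n, h6d⟩ := exec_shift Ω inp 1 s₁ r5 [] (by simp [hr5, h4']) (by simp)
  obtain ⟨r7, h7, h7', h7d, h7n⟩ := exec_shift Ω inp 2 s₂ r6 [] h6' (by simp)
  have h8 := ((h6.seq h7).seq (exec_instr Ω inp r7 [] (I := .sub 4 2 1) trivial)) P _ hc2
  set n₂ := s₁.cost inp nullEnv + 1 + (4 * s₁.eval inp nullEnv + 1) +
    (s₂.cost inp nullEnv + 1 + (4 * s₂.eval inp nullEnv + 1)) + 1 with hn₂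
  set r8 := (RamCfg.exec Ω inp ⟨0, r7, [], none⟩ (.sub 4 2 1)).reg with hr8
  -- The truncated difference vanishes exactly when the inequality to be tested holds.
  have e4 : r8 4 = (Ω w).den * 2 ^ s₂.eval inp nullEnv - (Ω w).num * 2 ^ s₁.eval inp nullEnv := by
    simp only [Nat.reduceSub] at h6d h7n
    simp [hr8, RamCfg.exec, RamCfg.set, h7d, h7n, h6d, h6n, hr5]
  have hfin : ∃ (pc : ℕ) (v : Bool), (v = true ↔ (Ω w).den * 2 ^ s₂.eval inp nullEnv ≤
      (Ω w).num * 2 ^ s₁.eval inp nullEnv) ∧ P[pc]? = some (.halt v) ∧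
      Reach P Ω inp ⟨o + 1, r5, [], none⟩ (n₂ + 1) ⟨pc, r8, [], none⟩ := by
    by_cases hle : (Ω w).den * 2 ^ s₂.eval inp nullEnv ≤ (Ω w).num * 2 ^ s₁.eval inp nullEnv
    · refine ⟨o' + 2, true, by simp [hle], hht, h8.trans ?_⟩
      refine .step rfl hjz (by simp) ?_
      have : r8 4 = 0 := by omega
      simp only [RamCfg.exec, this, if_true]
      exact .refl _
    · refine ⟨o' + 1, false, by simpa using hle, hhf, h8.trans ?_⟩
      refine .step rfl hjz (by simp) ?_
      have : r8 4 ≠ 0 := by omega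
      simp only [RamCfg.exec, this, if_false]
      exact .refl _
  obtain ⟨pc, v, hv, hpcv, hr⟩ := hfin
  have hask' : RamCfg.step P Ω inp ⟨o, r4, w, none⟩ = ⟨o + 1, r5, [], none⟩ :=
    RamCfg.step_eq (I := .ask 1 2) rfl hask
  have hlast : RamCfg.step P Ω inp ⟨pc, r8, [], none⟩ = ⟨pc, r8, [], some v⟩ :=
    RamCfg.step_eq (I := .halt v) rfl hpcv
  -- Once at the halt instruction the program counter stays there, so no later time counts as a
  -- query.
  have hend : ∀ t, ∃ ans, (RamCfg.step P Ω inp)^[t] ⟨pc, r8, [], none⟩ = ⟨pc, r8, [], ans⟩ := by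
    intro t
    induction t with
    | zero => exact ⟨_, rfl⟩
    | succ t ih =>
      obtain ⟨ans, h⟩ := ih
      rw [Function.iterate_succ_apply', h]
      cases ans with
      | none => exact ⟨_, hlast⟩
      | some u => exact ⟨some u, by simp [RamCfg.step]⟩
  have hrun1 : P.run Ω inp (n₁ + 1) = ⟨o + 1, r5, [], none⟩ := by
    rw [Program.run, Function.iterate_succ_apply', hm'.iterate, hask']
  have hrun2 : P.run Ω inp (n₂ + 1 + (n₁ + 1)) = ⟨pc, r8, [], none⟩ := by
    rw [Program.run, Function.iterate_add_apply]
    rw [Program.run] at hrun1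
    rw [hrun1, hr.iterate]
  refine ⟨⟨n₂ + 1 + (n₁ + 1) + 1, ?_, v, ?_, hv⟩, ?_⟩
  · have ha := hpa inp nullEnv _ le_rfl fun _ => Nat.zero_le _
    have hb := hpb inp nullEnv _ le_rfl fun _ => Nat.zero_le _
    have hl := hpl inp nullEnv _ le_rfl fun _ => Nat.zero_le _
    have hc := hpc inp nullEnv _ le_rfl fun _ => Nat.zero_le _
    have h1 := hp1 inp nullEnv _ le_rfl fun _ => Nat.zero_le _
    have h2 := hp2 inp nullEnv _ le_rfl fun _ => Nat.zero_le _
    simp only [NatExpr.cost] at hc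
    simp only [Polynomial.eval_add, Polynomial.eval_mul, Polynomial.eval_ofNat]
    omega
  · rw [Program.run, Function.iterate_succ_apply']
    rw [Program.run] at hrun2
    rw [hrun2, hlast]
  · rintro w' ⟨t, i, j, ht, rfl⟩
    rcases lt_trichotomy t n₁ with h | rfl | h
    · exact absurd ht (hm'.not_ask t h i j)
    · rw [Program.run, hm'.iterate]
    · obtain ⟨t, rfl⟩ : ∃ t', t = t' + (n₁ + 1) := ⟨t - (n₁ + 1), by omega⟩
      rw [Program.run, Function.iterate_add_apply, ← Program.run, hrun1] at ht
      by_cases h' : t < n₂ + 1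
      · exact absurd ht (hr.not_ask t h' i j)
      · obtain ⟨t, rfl⟩ : ∃ t', t = t' + (n₂ + 1) := ⟨t - (n₂ + 1), by omega⟩
        rw [Function.iterate_add_apply, hr.iterate] at ht
        obtain ⟨ans, h⟩ := hend t
        rw [h] at ht
        simp [hpcv] at ht

/-! ### Definable functions and predicates -/

/-- `f` is the value of an expression. -/
def Definable (f : List ℕ → (ℕ → ℕ) → ℕ) : Prop :=
  ∃ e : NatExpr, ∀ inp v, e.eval inp v = f inp v

open Classical in
/-- The indicator function of `p` is the value of an expression. -/
def DefinablePred (p : List ℕ → (ℕ → ℕ) → Prop) : Prop :=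
  Definable fun inp v => if p inp v then 1 else 0

namespace NatExpr

/-- Renaming of variables. -/
def rename : NatExpr → (ℕ → ℕ) → NatExpr
  | var n, ρ => var (ρ n)
  | const k, _ => const k
  | len, _ => len
  | entry a, ρ => entry (a.rename ρ)
  | add a b, ρ => add (a.rename ρ) (b.rename ρ)
  | sub a b, ρ => sub (a.rename ρ) (b.rename ρ)
  | sum a b, ρ => sum (a.rename ρ) (b.rename (push 0 fun n => ρ n + 1))

theorem eval_rename (inp : List ℕ) (e : NatExpr) : ∀ (ρ v : ℕ → ℕ),
    (e.rename ρ).eval inp v = e.eval inp fun n => v (ρ n) := by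
  induction e with
  | var n => simp [rename, eval]
  | const k => simp [rename, eval]
  | len => simp [rename, eval]
  | entry a iha => intro ρ v; simp [rename, eval, iha]
  | add a b iha ihb => intro ρ v; simp [rename, eval, iha, ihb]
  | sub a b iha ihb => intro ρ v; simp [rename, eval, iha, ihb]
  | sum a b iha ihb =>
    intro ρ v
    simp only [rename, eval, iha, ihb]
    refine Finset.sum_congr rfl fun i _ => congrArg _ (funext ?_)
    rintro (_ | n) <;> rfl

end NatExpr

namespace Definable

variable {f g : List ℕ → (ℕ → ℕ) → ℕ}

theorem var (n : ℕ) : Definable fun _ v => v n := ⟨.var n, fun _ _ => rfl⟩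

theorem const (k : ℕ) : Definable fun _ _ => k := ⟨.const k, fun _ _ => rfl⟩

theorem length : Definable fun inp _ => inp.length := ⟨.len, fun _ _ => rfl⟩

theorem entry : Definable f → Definable fun inp v => inp.getD (f inp v) 0 :=
  fun ⟨e, he⟩ => ⟨.entry e, fun inp v => by simp [NatExpr.eval, he]⟩

theorem add : Definable f → Definable g → Definable fun inp v => f inp v + g inp v :=
  fun ⟨e, he⟩ ⟨d, hd⟩ => ⟨.add e d, fun inp v => by simp [NatExpr.eval, he, hd]⟩

theorem sub : Definable f → Definable g → Definable fun inp v => f inp v - g inp v :=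
  fun ⟨e, he⟩ ⟨d, hd⟩ => ⟨.sub e d, fun inp v => by simp [NatExpr.eval, he, hd]⟩

theorem sum : Definable f → Definable g →
    Definable fun inp v => ∑ i ∈ Finset.range (f inp v), g inp (push i v) :=
  fun ⟨e, he⟩ ⟨d, hd⟩ => ⟨.sum e d, fun inp v => by simp [NatExpr.eval, he, hd]⟩

theorem weaken : Definable f → Definable fun inp v => f inp fun n => v (n + 1) :=
  fun ⟨e, he⟩ => ⟨e.rename (· + 1), fun inp v => by rw [NatExpr.eval_rename, he]⟩

/-- A product is a sum of equal terms. -/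
theorem mul (hf : Definable f) (hg : Definable g) :
    Definable fun inp v => f inp v * g inp v := by
  simpa [push] using hf.sum hg.weaken

end Definable

namespace DefinablePred

variable {f g : List ℕ → (ℕ → ℕ) → ℕ} {p q : List ℕ → (ℕ → ℕ) → Prop}

theorem congr (hp : DefinablePred p) (h : ∀ inp v, p inp v ↔ q inp v) : DefinablePred q := by
  have : p = q := funext fun inp => funext fun v => propext (h inp v)
  rwa [← this]

theorem not (hp : DefinablePred p) : DefinablePred fun inp v => ¬ p inp v := by
  obtain ⟨e, he⟩ := (Definable.const 1).sub hp
  refine ⟨e, fun inp v => ?_⟩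
  rw [he]
  by_cases h : p inp v <;> simp [h]

theorem and (hp : DefinablePred p) (hq : DefinablePred q) :
    DefinablePred fun inp v => p inp v ∧ q inp v := by
  obtain ⟨e, he⟩ := Definable.mul hp hq
  refine ⟨e, fun inp v => ?_⟩
  rw [he]
  by_cases h : p inp v <;> by_cases h' : q inp v <;> simp [h, h']

theorem or (hp : DefinablePred p) (hq : DefinablePred q) :
    DefinablePred fun inp v => p inp v ∨ q inp v :=
  (hp.not.and hq.not).not.congr fun _ _ => by tauto

theorem imp (hp : DefinablePred p) (hq : DefinablePred q) :
    DefinablePred fun inp v => p inp v → q inp v :=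
  (hp.and hq.not).not.congr fun _ _ => by tauto

/-- With truncated subtraction, `1 - (f - g)` is the indicator of `f ≤ g`. -/
theorem le (hf : Definable f) (hg : Definable g) :
    DefinablePred fun inp v => f inp v ≤ g inp v := by
  obtain ⟨e, he⟩ := (Definable.const 1).sub (hf.sub hg)
  refine ⟨e, fun inp v => ?_⟩
  rw [he]
  dsimp only
  split_ifs <;> omega

theorem lt (hf : Definable f) (hg : Definable g) :
    DefinablePred fun inp v => f inp v < g inp v :=
  le (hf.add (.const 1)) hg

theorem eq (hf : Definable f) (hg : Definable g) :
    DefinablePred fun inp v => f inp v = g inp v :=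
  ((le hf hg).and (le hg hf)).congr fun _ _ => by omega

theorem prop (P : Prop) : DefinablePred fun _ _ => P := by
  classical exact ⟨.const (if P then 1 else 0), fun _ _ => by simp [NatExpr.eval]⟩

/-- Only the finitely many truth values of `Q` below `D` matter. They are hard-wired into the
expression, so `Q` may be arbitrary. -/
theorem table (hf : Definable f) (Q : ℕ → Prop) (D : ℕ) :
    DefinablePred fun inp v => f inp v < D ∧ Q (f inp v) := by
  induction D with
  | zero => exact (prop False).congr fun _ _ => by simp
  | succ D ih =>
    refine (ih.or ((eq hf (.const D)).and (prop (Q D)))).congr fun inp v => ?_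
    constructor
    · rintro (⟨h, h'⟩ | ⟨h, h'⟩)
      · exact ⟨by omega, h'⟩
      · exact ⟨by omega, h ▸ h'⟩
    · rintro ⟨h, h'⟩
      rcases Nat.lt_succ_iff_lt_or_eq.1 h with h | h
      · exact .inl ⟨h, h'⟩
      · exact .inr ⟨h, h ▸ h'⟩

theorem table₂ (hf : Definable f) (hg : Definable g) (Q : ℕ → ℕ → Prop) (D : ℕ) :
    DefinablePred fun inp v => (f inp v < D ∧ g inp v < D) ∧ Q (f inp v) (g inp v) := by
  have hD : DefinablePred fun inp v => g inp v < D := lt hg (.const D)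
  suffices ∀ E, DefinablePred fun inp v =>
      (f inp v < E ∧ g inp v < D) ∧ Q (f inp v) (g inp v) from this D
  intro E
  induction E with
  | zero => exact (prop False).congr fun _ _ => by simp
  | succ E ih =>
    refine (ih.or ((eq hf (.const E)).and (table hg (Q E) D))).congr fun inp v => ?_
    constructor
    · rintro (⟨⟨h, h''⟩, h'⟩ | ⟨h, h'', h'⟩)
      · exact ⟨⟨by omega, h''⟩, h'⟩
      · exact ⟨⟨by omega, h''⟩, h ▸ h'⟩
    · rintro ⟨⟨h, h''⟩, h'⟩
      rcases Nat.lt_succ_iff_lt_or_eq.1 h with h | h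
      · exact .inl ⟨⟨h, h''⟩, h'⟩
      · exact .inr ⟨h, h'', h ▸ h'⟩

end DefinablePred

namespace Definable

variable {f g : List ℕ → (ℕ → ℕ) → ℕ}

theorem div (hf : Definable f) (hg : Definable g) :
    Definable fun inp v => f inp v / g inp v := by
  -- The quotient counts the `i < f` with `(i + 1) * g ≤ f`; the condition `0 < g` gives division by
  -- zero the value 0.
  obtain ⟨e, he⟩ := hf.sum ((DefinablePred.le (((var 0).add (const 1)).mul hg.weaken)
    hf.weaken).and (DefinablePred.lt (const 0) hg.weaken))
  refine ⟨e, fun inp v => ?_⟩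
  rw [he]
  have : (Finset.range (f inp v)).filter (fun i => (i + 1) * g inp v ≤ f inp v ∧ 0 < g inp v) =
      Finset.range (f inp v / g inp v) := by
    ext i
    rcases Nat.eq_zero_or_pos (g inp v) with h0 | h0
    · simp [h0]
    rw [Finset.mem_filter, Finset.mem_range, Finset.mem_range, ← Nat.le_div_iff_mul_le h0]
    have := Nat.div_le_self (f inp v) (g inp v)
    omega
  change _ = f inp v / g inp v
  rw [← Finset.card_range (f inp v / g inp v), ← this, Finset.card_filter]
  refine Finset.sum_congr rfl fun i _ => ?_
  by_cases h : (i + 1) * g inp v ≤ f inp v ∧ 0 < g inp v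
  · exact (if_pos h).trans (if_pos h).symm
  · exact (if_neg h).trans (if_neg h).symm

theorem mod (hf : Definable f) (hg : Definable g) :
    Definable fun inp v => f inp v % g inp v := by
  obtain ⟨e, he⟩ := hf.sub (hg.mul (hf.div hg))
  refine ⟨e, fun inp v => ?_⟩
  rw [he]
  have := Nat.div_add_mod (f inp v) (g inp v)
  dsimp only
  omega

theorem polynomial (hf : Definable f) (p : Polynomial ℕ) :
    Definable fun inp v => p.eval (f inp v) := by
  induction p using Polynomial.induction_on with
  | C a => simpa using const a
  | add p q hp hq => simpa using hp.add hq
  | monomial n a h => simpa [pow_succ, mul_assoc] using h.mul hf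

end Definable

/-! ### Bounds for the number of left independent sets -/

namespace BipGraph

theorem two_pow_le_leftIS (G : BipGraph) (F : Finset (Fin G.a)) (A : Finset (Fin G.b))
    (h : ∀ u ∈ F, ∀ v ∈ A, (u, v) ∉ G.E) : 2 ^ A.card ≤ G.leftIS F.card := by
  classical
  rw [← Finset.card_powerset]
  refine Finset.card_le_card_of_injOn (fun T => F.disjSum T) ?_ ?_
  · intro T hT
    have hT : T ⊆ A := by simpa using hT
    simp only [Finset.coe_filter, Finset.mem_univ, true_and, Set.mem_ofPred_eq,
      Finset.toLeft_disjSum, and_true]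
    rintro x hx y hy -
    simp only [graph, SimpleGraph.fromRel_adj]
    rintro ⟨-, ⟨u, v, rfl, rfl, huv⟩ | ⟨u, v, rfl, rfl, huv⟩⟩
    · exact h u (by simpa using hx) v (hT (by simpa using hy)) huv
    · exact h u (by simpa using hy) v (hT (by simpa using hx)) huv
  · intro T _ T' _ h
    simpa using congrArg Finset.toRight h

-- A left independent set is determined by its left part, of which there are at most `2 ^ G.a`, and
-- a set of right vertices not adjacent to that part.
open Classical in
theorem leftIS_le (G : BipGraph) (l m : ℕ)
    (h : ∀ F : Finset (Fin G.a), F.card = l →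
      (Finset.univ.filter fun v => ∀ u ∈ F, (u, v) ∉ G.E).card ≤ m) :
    G.leftIS l ≤ 2 ^ G.a * 2 ^ m := by
  have h1 : G.leftIS l ≤ ((Finset.univ.filter fun F : Finset (Fin G.a) => F.card = l).sigma
      fun F => (Finset.univ.filter fun v => ∀ u ∈ F, (u, v) ∉ G.E).powerset).card := by
    refine Finset.card_le_card_of_injOn (fun S => ⟨S.toLeft, S.toRight⟩) ?_ ?_
    · intro S hS
      simp only [Finset.coe_filter, Finset.mem_univ, true_and, Set.mem_ofPred_eq] at hS
      simp only [Finset.coe_sigma, Set.mem_sigma_iff, Finset.coe_filter, Finset.mem_univ, true_and,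
        Set.mem_ofPred_eq, hS.2, Finset.mem_coe, Finset.mem_powerset]
      intro v hv
      simp only [Finset.mem_filter, Finset.mem_univ, true_and]
      intro u hu huv
      refine hS.1 (x := Sum.inl u) (by simpa using hu) (y := Sum.inr v) (by simpa using hv)
        (by simp) ?_
      simp only [graph, SimpleGraph.fromRel_adj]
      exact ⟨by simp, .inl ⟨u, v, rfl, rfl, huv⟩⟩
    · intro S _ S' _ h
      simp only [Sigma.mk.injEq, heq_eq_eq] at h
      rw [← S.toLeft_disjSum_toRight, ← S'.toLeft_disjSum_toRight, h.1, h.2]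
  refine h1.trans ?_
  rw [Finset.card_sigma]
  refine (Finset.sum_le_card_nsmul _ _ (2 ^ m) fun F hF => ?_).trans ?_
  · rw [Finset.card_powerset]
    exact Nat.pow_le_pow_right (by omega) (h F (by simpa using hF))
  · rw [smul_eq_mul]
    refine Nat.mul_le_mul_right _ ((Finset.card_le_univ _).trans ?_)
    simp

end BipGraph

/-- Quotient and remainder identify `Fin (m * n)` with pairs. On the left of the gadget these are
the two entries of a pair, on the right a number and the index of its copy. -/
theorem card_filter_div_mod (m n : ℕ) (S T : Finset ℕ) (hS : S ⊆ Finset.range m)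
    (hT : T ⊆ Finset.range n) :
    (Finset.univ.filter fun u : Fin (m * n) => u.1 / n ∈ S ∧ u.1 % n ∈ T).card =
      S.card * T.card := by
  rw [← Finset.card_product]
  have hb : ∀ x ∈ S ×ˢ T, x.1 < m ∧ x.2 < n := fun x hx => by
    rw [Finset.mem_product] at hx
    exact ⟨Finset.mem_range.1 (hS hx.1), Finset.mem_range.1 (hT hx.2)⟩
  symm
  refine Finset.card_bij (fun x hx => ⟨x.1 * n + x.2, by
    obtain ⟨h1, h2⟩ := hb x hx
    calc x.1 * n + x.2 < x.1 * n + n := by omega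
      _ = (x.1 + 1) * n := by ring
      _ ≤ m * n := Nat.mul_le_mul_right _ h1⟩) ?_ ?_ ?_
  · intro x hx
    have h2 := (hb x hx).2
    have : 0 < n := by omega
    rw [Finset.mem_product] at hx
    simpa [Nat.mod_eq_of_lt h2, Nat.div_eq_of_lt h2, Nat.add_div_of_dvd_right,
      Nat.mul_div_cancel _ this] using hx
  · intro x hx y hy h
    have h2 := (hb x hx).2
    have h2' := (hb y hy).2
    have : 0 < n := by omega
    simp only [Fin.mk.injEq] at h
    have e1 := congrArg (· % n) h
    have e2 := congrArg (· / n) h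
    simp [Nat.mod_eq_of_lt h2, Nat.mod_eq_of_lt h2', Nat.div_eq_of_lt h2, Nat.div_eq_of_lt h2',
      Nat.add_div_of_dvd_right, Nat.mul_div_cancel _ this] at e1 e2
    exact Prod.ext e2 e1
  · intro u hu
    simp only [Finset.mem_filter, Finset.mem_univ, true_and] at hu
    exact ⟨(u.1 / n, u.1 % n), Finset.mem_product.2 hu, by
      ext; simpa [mul_comm] using Nat.div_add_mod u.1 n⟩

/-! ### The gadget -/

/-- `R` has a set of `K` numbers below `N` that are all pairwise, and each to itself, related. -/
def HasCliqueSet (N K : ℕ) (R : ℕ → ℕ → Prop) : Prop :=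
  ∃ S : Finset ℕ, S ⊆ Finset.range N ∧ S.card = K ∧ ∀ i ∈ S, ∀ j ∈ S, R i j

/-- Is the pair with number `u` adjacent to the copy with number `v`? Pairs in `R` are adjacent to
the copies of their two entries, other pairs to all copies. -/
def GadgetAdj (N t : ℕ) (R : ℕ → ℕ → Prop) (u v : ℕ) : Prop :=
  ¬ R (u / N) (u % N) ∨ v / t = u / N ∨ v / t = u % N

/-- On the left the pairs of numbers below `N`, on the right `t` copies of each number below
`N + K + 1`. -/
def gadget (N K t : ℕ) (R : ℕ → ℕ → Prop) (ht : 0 < t) : BipGraph where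
  a := N * N
  b := (N + K + 1) * t
  E := {x | GadgetAdj N t R x.1 x.2}
  nonempty := by positivity

section gadget

variable {N K t : ℕ} {R : ℕ → ℕ → Prop} (ht : 0 < t)

theorem notMem_gadget (u : Fin (N * N)) (v : Fin ((N + K + 1) * t)) :
    (u, v) ∉ (gadget N K t R ht).E ↔
      R (u / N) (u % N) ∧ v.1 / t ≠ u / N ∧ v.1 / t ≠ u % N := by
  change ¬ GadgetAdj N t R u v ↔ _
  simp only [GadgetAdj, not_or, not_not, ne_eq]

theorem le_leftIS_gadget (h : HasCliqueSet N K R) :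
    2 ^ (t * (N + 1)) ≤ (gadget N K t R ht).leftIS (K * K) := by
  obtain ⟨S, hS, hK, hR⟩ := h
  have hS' : S ⊆ Finset.range (N + K + 1) := hS.trans (Finset.range_subset_range.2 (by omega))
  have h1 := card_filter_div_mod N N S S hS hS
  have h2 := card_filter_div_mod (N + K + 1) t (Finset.range (N + K + 1) \ S) (Finset.range t)
    Finset.sdiff_subset subset_rfl
  rw [Finset.card_sdiff_of_subset hS', Finset.card_range, Finset.card_range, hK,
    show N + K + 1 - K = N + 1 by omega, mul_comm (N + 1)] at h2
  rw [hK] at h1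
  rw [← h1, ← h2]
  refine (gadget N K t R ht).two_pow_le_leftIS _ _ ?_
  intro u hu v hv
  obtain ⟨-, hu₁, hu₂⟩ := (@Finset.mem_filter (Fin (N * N)) _ _ _ _).1 hu
  obtain ⟨-, hv, -⟩ := (@Finset.mem_filter (Fin ((N + K + 1) * t)) _ _ _ _).1 hv
  have hv := (Finset.mem_sdiff.1 hv).2
  exact (notMem_gadget ht u v).2
    ⟨hR _ hu₁ _ hu₂, fun h => hv (h ▸ hu₁), fun h => hv (h ▸ hu₂)⟩

theorem card_free_le (ht : 0 < t) (h : ¬ HasCliqueSet N K R) (F : Finset (Fin (N * N)))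
    (hF : F.card = K * K) (A : Finset (Fin ((N + K + 1) * t))) (hA : ∀ v ∈ A, ∀ u ∈ F,
      R (u.1 / N) (u.1 % N) ∧ v.1 / t ≠ u / N ∧ v.1 / t ≠ u % N) : A.card ≤ t * N := by
  -- A single free right vertex already shows that all chosen pairs are in `R`.
  rcases A.eq_empty_or_nonempty with h0 | ⟨v₀, hv₀⟩
  · simp [h0]
  have hRF : ∀ u ∈ F, R (u.1 / N) (u.1 % N) := fun u hu => (hA v₀ hv₀ u hu).1
  set S : Finset ℕ := F.image (fun u => u.1 / N) ∪ F.image (fun u => u.1 % N) with hS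
  have hlt : ∀ u : Fin (N * N), u.1 / N < N ∧ u.1 % N < N := fun u => by
    have : 0 < N := Nat.pos_of_ne_zero fun h => by simpa [h] using u.2
    exact ⟨Nat.div_lt_of_lt_mul u.2, Nat.mod_lt _ this⟩
  have hSN : S ⊆ Finset.range N := by
    refine Finset.union_subset ?_ ?_ <;> refine Finset.image_subset_iff.2 fun u _ => ?_
    · exact Finset.mem_range.2 (hlt u).1
    · exact Finset.mem_range.2 (hlt u).2
  have hcard := card_filter_div_mod N N S S hSN hSN
  have hFS : F ⊆ Finset.univ.filter fun u : Fin (N * N) => u.1 / N ∈ S ∧ u.1 % N ∈ S := by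
    intro u hu
    refine Finset.mem_filter.2 ⟨Finset.mem_univ _, Finset.mem_union_left _ ?_,
      Finset.mem_union_right _ ?_⟩
    · exact Finset.mem_image_of_mem (fun u : Fin (N * N) => u.1 / N) hu
    · exact Finset.mem_image_of_mem (fun u : Fin (N * N) => u.1 % N) hu
  have hKS : K ≤ S.card := by
    by_contra! hlt
    have := Finset.card_le_card hFS
    rw [hcard] at this
    have h3 := Nat.mul_self_lt_mul_self hlt
    have : F.card = K * K := hF
    omega
  -- If only `K` numbers occurred, the `K * K` pairs of `F` would fill `S ×ˢ S`, and `S` would be a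
  -- clique set.
  have hKS' : K < S.card := by
    refine lt_of_le_of_ne hKS fun hK => h ⟨S, hSN, hK.symm, fun i hi j hj => ?_⟩
    have hFe := Finset.eq_of_subset_of_card_le hFS (by rw [hcard, ← hK]; exact hF.ge)
    have hi' := Finset.mem_range.1 (hSN hi)
    have hj' := Finset.mem_range.1 (hSN hj)
    have hN : 0 < N := by omega
    have e1 : (i * N + j) / N = i := by
      rw [Nat.add_div_of_dvd_right (Dvd.intro_left _ rfl), Nat.mul_div_cancel _ hN,
        Nat.div_eq_of_lt hj', add_zero]
    have e2 : (i * N + j) % N = j := by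
      rw [Nat.mul_add_mod_self_right, Nat.mod_eq_of_lt hj']
    have hu : i * N + j < N * N := by nlinarith
    have : (⟨i * N + j, hu⟩ : Fin (N * N)) ∈ F := by
      rw [hFe, Finset.mem_filter]
      exact ⟨Finset.mem_univ _, by simpa [e1] using hi, by simpa [e2] using hj⟩
    have := hRF _ this
    simpa only [e1, e2] using this
  have hcard2 := card_filter_div_mod (N + K + 1) t (Finset.range (N + K + 1) \ S) (Finset.range t)
    Finset.sdiff_subset subset_rfl
  rw [Finset.card_sdiff_of_subset (hSN.trans (Finset.range_subset_range.2 (by omega))),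
    Finset.card_range, Finset.card_range] at hcard2
  have hsub : A ⊆
      Finset.univ.filter fun v : Fin ((N + K + 1) * t) =>
        v.1 / t ∈ Finset.range (N + K + 1) \ S ∧ v.1 % t ∈ Finset.range t := by
    intro v hv
    refine Finset.mem_filter.2 ⟨Finset.mem_univ _, Finset.mem_sdiff.2 ⟨Finset.mem_range.2
      (Nat.div_lt_of_lt_mul (v.2.trans_eq (mul_comm _ _))), fun hvS => ?_⟩,
      Finset.mem_range.2 (Nat.mod_lt _ ht)⟩
    have hv' := hA v hv
    rcases Finset.mem_union.1 hvS with hvS | hvS <;> obtain ⟨u, hu, he⟩ := Finset.mem_image.1 hvS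
    · exact (hv' u hu).2.1 he.symm
    · exact (hv' u hu).2.2 he.symm
  refine (Finset.card_le_card hsub).trans ?_
  rw [hcard2, mul_comm]
  exact Nat.mul_le_mul_left _ (by omega)

theorem leftIS_gadget_le (h : ¬ HasCliqueSet N K R) :
    (gadget N K t R ht).leftIS (K * K) ≤ 2 ^ (N * N) * 2 ^ (t * N) := by
  classical
  exact (gadget N K t R ht).leftIS_le _ _ fun F hF => card_free_le ht h F hF _ fun v hv u hu =>
    (notMem_gadget ht u v).1 ((Finset.mem_filter.1 hv).2 u hu)

end gadget

/-! ### Flattening the biadjacency matrix -/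

theorem flatMap_range (F : ℕ → ℕ → ℕ) (a b : ℕ) :
    ((List.range a).flatMap fun u => (List.range b).map fun v => F u v) =
      (List.range (a * b)).map fun x => F (x / b) (x % b) := by
  induction a with
  | zero => simp
  | succ a ih =>
    rw [List.range_succ, List.flatMap_append, ih, Nat.succ_mul, List.range_add, List.map_append]
    congr 1
    simp only [List.flatMap_cons, List.flatMap_nil, List.append_nil, List.map_map]
    refine List.map_congr_left fun v hv => ?_
    have hv := List.mem_range.1 hv
    have hb : 0 < b := by omega
    simp only [Function.comp_apply]
    rw [Nat.add_div_of_dvd_right (Dvd.intro_left _ rfl), Nat.mul_div_cancel _ hb,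
        Nat.div_eq_of_lt hv, add_zero, Nat.mul_add_mod_self_right, Nat.mod_eq_of_lt hv]

theorem flatMap_finRange (F : ℕ → ℕ → ℕ) (a b : ℕ) :
    ((List.finRange a).flatMap fun u => (List.finRange b).map fun v => F u.1 v.1) =
      (List.range (a * b)).map fun x => F (x / b) (x % b) := by
  rw [← flatMap_range, ← List.map_coe_finRange_eq_range (n := a), ← List.map_coe_finRange_eq_range (n := b)]
  simp only [List.flatMap_map, List.map_map]
  rfl

-- With a single index for all matrix entries, the query has the form that the one output loop of
-- `exists_program` produces.
open Classical in
theorem enc_gadget {N K t : ℕ} {R : ℕ → ℕ → Prop} (ht : 0 < t) (l : ℕ) :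
    (gadget N K t R ht).enc l = N * N :: (N + K + 1) * t :: l ::
      (List.range (N * N * ((N + K + 1) * t))).map fun x =>
        if GadgetAdj N t R (x / ((N + K + 1) * t)) (x % ((N + K + 1) * t)) then 1 else 0 :=
  congrArg (fun r => N * N :: (N + K + 1) * t :: l :: r)
    (flatMap_finRange (fun u v => if GadgetAdj N t R u v then 1 else 0) _ _)

/-! ### The generic reduction -/

theorem exists_mul_lt_two_pow (k : ℕ) : ∃ j, k * (j + 4) + 1 < 2 ^ j := by
  refine ⟨2 * k + 4, ?_⟩
  have h : k < 2 ^ k := Nat.lt_two_pow_self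
  have : 2 ^ (2 * k + 4) = 16 * (2 ^ k * 2 ^ k) := by ring
  rw [this]
  nlinarith [Nat.mul_le_mul h h]

/-- The order of the gadget is polynomial in `N + K + 1` and linear in `C`, so its `k`-th power
loses against an exponential in `C * (N + K + 1)`, with one `C` for all `N` and `K`. -/
theorem exists_pow_lt_two_pow (k : ℕ) : ∃ C, 0 < C ∧ ∀ N K : ℕ,
    (N * N + (N + K + 1) * (N * N + 2 * (C * (N + K + 1)))) ^ k < 2 ^ (C * (N + K + 1)) := by
  obtain ⟨j, hj⟩ := exists_mul_lt_two_pow k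
  -- This choice makes `2 + 2 * C` the power `2 ^ (j + 1)`, while `k * (j + 4) < C` still holds.
  refine ⟨2 ^ j - 1, by omega, fun N K => ?_⟩
  set m := N + K + 1 with hm
  set C := 2 ^ j - 1 with hC
  have hNm : N ≤ m := by omega
  have h1m : 1 ≤ m := by omega
  have h1 : N * N + m * (N * N + 2 * (C * m)) ≤ 2 ^ (j + 1 + 3 * m) := by
    have hm2 : m ≤ 2 ^ m := Nat.lt_two_pow_self.le
    have hN2 : N * N ≤ m * m := Nat.mul_le_mul hNm hNm
    have e : 2 ^ (j + 1) = 2 + 2 * C := by rw [pow_succ]; omega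
    have hmm : m * m ≤ m * m * m := Nat.le_mul_of_pos_right _ h1m
    calc N * N + m * (N * N + 2 * (C * m)) ≤ m * m * m + m * (m * m) + 2 * C * (m * m) := by
          nlinarith [Nat.mul_le_mul_left m hN2]
      _ ≤ (2 + 2 * C) * (m * m * m) := by nlinarith [Nat.mul_le_mul_left (2 * C) hmm]
      _ ≤ (2 + 2 * C) * (2 ^ m * 2 ^ m * 2 ^ m) := by gcongr
      _ = 2 ^ (j + 1 + 3 * m) := by rw [← e]; ring
  calc (N * N + m * (N * N + 2 * (C * m))) ^ k ≤ (2 ^ (j + 1 + 3 * m)) ^ k :=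
        Nat.pow_le_pow_left h1 k
    _ = 2 ^ ((j + 1 + 3 * m) * k) := by rw [pow_mul]
    _ < 2 ^ (C * m) := by
        refine Nat.pow_lt_pow_right (by omega) ?_
        have : k * (j + 4) < C := by omega
        calc (j + 1 + 3 * m) * k ≤ (k * (j + 4)) * m := by nlinarith [Nat.zero_le (k * j)]
          _ < C * m := Nat.mul_lt_mul_of_pos_right this h1m

theorem hasCliqueSet_iff {c : ℝ} {N K s t : ℕ} {R : ℕ → ℕ → Prop} (ht : 0 < t)
    (hst : t = N * N + 2 * s) (hs : ((N * N + (N + K + 1) * t : ℕ) : ℝ) ^ c < 2 ^ s) {z : NNRat}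
    (hz : (approxLeftIS c).sol (gadget N K t R ht, K * K) z) :
    z.den * 2 ^ (t * (N + 1)) ≤ z.num * 2 ^ s ↔ HasCliqueSet N K R := by
  obtain ⟨h1, h2⟩ := hz
  simp only [BipGraph.order] at h1 h2
  change ((N * N + (N + K + 1) * t : ℕ) : ℝ) ^ (-c) * _ ≤ _ at h1
  change _ ≤ ((N * N + (N + K + 1) * t : ℕ) : ℝ) ^ c * _ at h2
  set n := N * N + (N + K + 1) * t
  have hn : (0 : ℝ) < n := by
    have : 0 < n := by positivity
    exact_mod_cast this
  have hden : (0 : ℝ) < z.den := by exact_mod_cast z.den_pos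
  have hzq : (z : ℝ) = z.num / z.den := NNRat.cast_def z
  have hpow : (0 : ℝ) < (n : ℝ) ^ c := Real.rpow_pos_of_pos hn c
  have hkey : z.den * 2 ^ (t * (N + 1)) ≤ z.num * 2 ^ s ↔
      (2 : ℝ) ^ (t * (N + 1)) ≤ z * 2 ^ s := by
    rw [hzq, div_mul_eq_mul_div, le_div_iff₀ hden, mul_comm (2 ^ (t * (N + 1)) : ℝ)]
    exact_mod_cast Iff.rfl
  rw [hkey]
  constructor
  · intro h
    by_contra hno
    have h3 : ((gadget N K t R ht).leftIS (K * K) : ℝ) ≤ 2 ^ (N * N) * 2 ^ (t * N) := by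
      exact_mod_cast leftIS_gadget_le ht hno
    have h4 : (z : ℝ) * 2 ^ s < 2 ^ s * (2 ^ (N * N) * 2 ^ (t * N)) * 2 ^ s := by
      gcongr
      calc (z : ℝ) ≤ (n : ℝ) ^ c * (2 ^ (N * N) * 2 ^ (t * N)) := h2.trans (by gcongr)
        _ < 2 ^ s * (2 ^ (N * N) * 2 ^ (t * N)) := by gcongr
    -- The value of `t` is chosen for this: one factor `2 ^ s` pays for the error of the answer, the
    -- other for the slack in the test.
    have h5 : (2 : ℝ) ^ s * (2 ^ (N * N) * 2 ^ (t * N)) * 2 ^ s = 2 ^ (t * (N + 1)) := by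
      rw [← pow_add, ← pow_add, ← pow_add]
      congr 1
      rw [Nat.mul_add, mul_one]
      omega
    linarith
  · intro h
    have h3 : (2 : ℝ) ^ (t * (N + 1)) ≤ (gadget N K t R ht).leftIS (K * K) := by
      exact_mod_cast le_leftIS_gadget ht h
    rw [Real.rpow_neg hn.le, inv_mul_le_iff₀ hpow] at h1
    calc (2 : ℝ) ^ (t * (N + 1)) ≤ (n : ℝ) ^ c * z := h3.trans h1
      _ ≤ 2 ^ s * z := by gcongr
      _ = z * 2 ^ s := mul_comm _ _

/-- The hypothesis on `R` ranges over all definable arguments, so that decoded vertex numbers can be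
inserted without a substitution operation on expressions. -/
theorem exists_reduction {c : ℝ} {N K : List ℕ → ℕ} {R : List ℕ → ℕ → ℕ → Prop}
    (hN : Definable fun inp _ => N inp) (hK : Definable fun inp _ => K inp)
    (hR : ∀ f g, Definable f → Definable g → DefinablePred fun inp v =>
      R inp (f inp v) (g inp v)) :
    ∃ (P : Program) (p : Polynomial ℕ), ∀ Ω : Oracle, (approxLeftIS c).IsSolvedBy Ω →
      ∀ inp : List ℕ,
        P.DecidesWithin Ω inp (p.eval (magnitude inp)) (HasCliqueSet (N inp) (K inp) (R inp)) ∧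
        ∀ w, P.Queries Ω inp w → ∃ y : (approxLeftIS c).Inst,
          w = (approxLeftIS c).enc y ∧ (approxLeftIS c).param y = K inp * K inp := by
  -- The order is at least 1, so the real exponent `c` may be replaced by a larger natural number.
  obtain ⟨k, hk⟩ := exists_nat_ge c
  obtain ⟨C, hC0, hC⟩ := exists_pow_lt_two_pow k
  set s : List ℕ → ℕ := fun inp => C * (N inp + K inp + 1) with hs
  set t : List ℕ → ℕ := fun inp => N inp * N inp + 2 * s inp with ht
  have ht0 : ∀ inp, 0 < t inp := fun inp => by positivity
  set b : List ℕ → ℕ := fun inp => (N inp + K inp + 1) * t inp with hb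
  have hb0 : ∀ inp, 0 < b inp := fun inp => by have := ht0 inp; positivity
  have ds : Definable fun inp _ => s inp := (Definable.const C).mul ((hN.add hK).add (.const 1))
  have dt : Definable fun inp _ => t inp := (hN.mul hN).add ((Definable.const 2).mul ds)
  have db : Definable fun inp _ => b inp := ((hN.add hK).add (.const 1)).mul dt
  -- Variable 0 is the index in the flattened matrix: its quotient by `b` is the row, its remainder
  -- the column.
  have dadj : DefinablePred fun inp v =>
      GadgetAdj (N inp) (t inp) (R inp) (v 0 / b inp) (v 0 % b inp) := by
    have du := (Definable.var 0).div db
    have dv := ((Definable.var 0).mod db).div dt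
    exact (hR _ _ (du.div hN) (du.mod hN)).not.or
      ((DefinablePred.eq dv (du.div hN)).or (DefinablePred.eq dv (du.mod hN)))
  obtain ⟨ea, ha⟩ := hN.mul hN
  obtain ⟨eb, heb⟩ := id db
  obtain ⟨el, hl⟩ := hK.mul hK
  obtain ⟨ec, hc⟩ := (hN.mul hN).mul db
  obtain ⟨ee, he⟩ := dadj
  obtain ⟨e1, h1⟩ := id ds
  obtain ⟨e2, h2⟩ := dt.mul (hN.add (.const 1))
  obtain ⟨P, p, hP⟩ := exists_program ea eb el ec ee e1 e2
  refine ⟨P, p, fun Ω hΩ inp => ?_⟩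
  obtain ⟨hd, hq⟩ := hP Ω inp
    ((approxLeftIS c).enc (gadget (N inp) (K inp) (t inp) (R inp) (ht0 inp), K inp * K inp)) (by
      rw [ha, heb, hl, hc]
      simp only [he]
      exact enc_gadget (ht0 inp) _)
  have hn := hC (N inp) (K inp)
  rw [h1, h2, hasCliqueSet_iff (ht0 inp) rfl ?_ (hΩ (_, _))] at hd
  · exact ⟨hd, fun w hw => ⟨_, hq w hw, rfl⟩⟩
  · have h1n : 1 ≤ N inp * N inp + (N inp + K inp + 1) * t inp := by
      have := hb0 inp
      simp only [b] at this
      omega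
    calc ((N inp * N inp + (N inp + K inp + 1) * t inp : ℕ) : ℝ) ^ c
        ≤ ((N inp * N inp + (N inp + K inp + 1) * t inp : ℕ) : ℝ) ^ (k : ℝ) :=
          Real.rpow_le_rpow_of_exponent_le (by exact_mod_cast h1n) hk
      _ < 2 ^ s inp := by
          rw [Real.rpow_natCast]
          exact_mod_cast hn

/-! ### W[1]-hardness -/

theorem Polynomial.eval_le_mul_pow (p : Polynomial ℕ) {m : ℕ} (hm : 1 ≤ m) :
    p.eval m ≤ p.eval 1 * m ^ p.natDegree := by
  rw [Polynomial.eval_eq_sum_range, Polynomial.eval_eq_sum_range, Finset.sum_mul]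
  refine Finset.sum_le_sum fun i hi => ?_
  rw [one_pow, mul_one]
  exact Nat.mul_le_mul_left _ (Nat.pow_le_pow_right hm (Finset.mem_range_succ_iff.1 hi))

theorem computable_mul_pow (A d : ℕ) : Computable fun k : ℕ => A * (3 * (k + 1)) ^ d := by
  apply Primrec.to_comp
  refine Primrec.nat_mul.comp (Primrec.const A) ?_
  induction d with
  | zero => simpa using Primrec.const 1
  | succ d ih =>
    simp only [pow_succ]
    exact Primrec.nat_mul.comp ih (Primrec.nat_mul.comp (Primrec.const 3) Primrec.succ)

theorem length_le_inputSize (w : List ℕ) : w.length ≤ inputSize w := by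
  rw [inputSize]
  simp

namespace CliqueInst

variable (x : CliqueInst)

/-- Adjacency of vertices given by their numbers. -/
def AdjNat (i j : ℕ) : Prop := ∃ (hi : i < x.n) (hj : j < x.n), x.G.Adj ⟨i, hi⟩ ⟨j, hj⟩

open Classical in
theorem enc_eq : x.enc = x.n :: x.k ::
    (List.range (x.n * x.n)).map fun m => if x.AdjNat (m / x.n) (m % x.n) then 1 else 0 := by
  rw [← flatMap_finRange fun i j => if x.AdjNat i j then 1 else 0, enc]
  simp [AdjNat]

/-- The number `k` contributes its value to `magnitude` but only its bit length to `inputSize`; the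
excess is a factor depending on the parameter, which FPT time allows. -/
theorem magnitude_le : magnitude x.enc ≤ 3 * (x.k + 1) * inputSize x.enc := by
  have h1 := length_le_inputSize x.enc
  have h2 : magnitude x.enc ≤ 2 + x.n * x.n + (x.n + (x.k + x.n * x.n)) := by
    classical
    rw [magnitude, enc_eq]
    simp only [List.length_cons, List.length_map, List.length_range, List.sum_cons]
    have := List.sum_le_card_nsmul ((List.range (x.n * x.n)).map fun m =>
      if x.AdjNat (m / x.n) (m % x.n) then 1 else 0) 1 (by
        intro y hy
        obtain ⟨m, -, rfl⟩ := List.mem_map.1 hy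
        split_ifs <;> omega)
    simp only [List.length_map, List.length_range, smul_eq_mul, mul_one] at this
    omega
  have h3 : x.enc.length = 2 + x.n * x.n := by
    rw [enc_eq]
    simp
    omega
  have h4 : x.n ≤ x.n * x.n := Nat.le_mul_self _
  nlinarith [Nat.zero_le (x.k * (x.n * x.n))]

/-- The alternative `i = j` supplies the reflexivity that `HasCliqueSet` demands. The matrix starts
at entry 2 of the input. -/
theorem hasCliqueSet_iff : HasCliqueSet (x.enc.getD 0 0) (x.enc.getD 1 0)
      (fun i j => i = j ∨ x.enc.getD (2 + (i * x.enc.getD 0 0 + j)) 0 = 1) ↔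
    ∃ s : Finset (Fin x.n), x.G.IsNClique x.k s := by
  have e0 : x.enc.getD 0 0 = x.n := by simp [enc_eq]
  have e1 : x.enc.getD 1 0 = x.k := by simp [enc_eq]
  have e2 : ∀ i j, i < x.n → j < x.n →
      (x.enc.getD (2 + (i * x.n + j)) 0 = 1 ↔ x.AdjNat i j) := by
    intro i j hi hj
    have hlt : i * x.n + j < x.n * x.n := by nlinarith
    have e1 : (i * x.n + j) / x.n = i := by
      rw [Nat.add_div_of_dvd_right (Dvd.intro_left _ rfl), Nat.mul_div_cancel _ (by omega),
        Nat.div_eq_of_lt hj, add_zero]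
    have e2 : (i * x.n + j) % x.n = j := by
      rw [Nat.mul_add_mod_self_right, Nat.mod_eq_of_lt hj]
    rw [add_comm 2, enc_eq]
    simp [List.getD_eq_getElem?_getD, hlt, e1, e2]
  rw [e0, e1]
  constructor
  · rintro ⟨S, hS, hk, hR⟩
    have hlt : ∀ m ∈ S, m < x.n := fun m hm => Finset.mem_range.1 (hS hm)
    refine ⟨S.attachFin hlt, ?_, by rw [Finset.card_attachFin, hk]⟩
    intro i hi j hj hij
    have hi := Finset.mem_attachFin hlt |>.1 hi
    have hj := Finset.mem_attachFin hlt |>.1 hj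
    rcases hR _ hi _ hj with h | h
    · exact absurd (Fin.ext h) hij
    · obtain ⟨_, _, h⟩ := (e2 _ _ i.2 j.2).1 h
      exact h
  · rintro ⟨s, hs, hk⟩
    refine ⟨s.map Fin.valEmbedding, ?_, by rw [Finset.card_map, hk], ?_⟩
    · intro m hm
      obtain ⟨i, -, rfl⟩ := Finset.mem_map.1 hm
      exact Finset.mem_range.2 i.2
    · intro m hm m' hm'
      obtain ⟨i, hi, rfl⟩ := Finset.mem_map.1 hm
      obtain ⟨j, hj, rfl⟩ := Finset.mem_map.1 hm'
      by_cases hij : i = j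
      · exact .inl (by rw [hij])
      · exact .inr ((e2 _ _ i.2 j.2).2 ⟨i.2, j.2, hs hi hj hij⟩)

end CliqueInst

theorem w1Hard_approxLeftIS (c : ℝ) : W1Hard (approxLeftIS c) := by
  have d0 : Definable fun inp _ => inp.getD 0 0 := (Definable.const 0).entry
  have d1 : Definable fun inp _ => inp.getD 1 0 := (Definable.const 1).entry
  obtain ⟨P, p, h⟩ := exists_reduction (c := c)
    (R := fun inp i j => i = j ∨ inp.getD (2 + (i * inp.getD 0 0 + j)) 0 = 1) d0 d1
    fun f g hf hg => (DefinablePred.eq hf hg).or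
      (DefinablePred.eq ((Definable.const 2).add ((hf.mul d0).add hg)).entry (.const 1))
  refine ⟨P, fun k => p.eval 1 * (3 * (k + 1)) ^ p.natDegree, fun k => k * k, p.natDegree,
    computable_mul_pow _ _, (Primrec.nat_mul.comp .id .id).to_comp, fun Ω hΩ (x : CliqueInst) => ?_⟩
  obtain ⟨⟨t, ht, b, hb, hb'⟩, hq⟩ := h Ω hΩ x.enc
  rw [x.hasCliqueSet_iff] at hb'
  refine ⟨⟨t, ht.trans ?_, b, hb, hb'⟩, fun w hw => ?_⟩
  · have h1 : 1 ≤ 3 * (x.k + 1) * inputSize x.enc := by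
      have := length_le_inputSize x.enc
      rw [CliqueInst.enc_eq, List.length_cons] at this
      rw [CliqueInst.enc_eq]
      nlinarith
    calc p.eval (magnitude x.enc) ≤ p.eval (3 * (x.k + 1) * inputSize x.enc) :=
          polynomial_eval_mono p x.magnitude_le
      _ ≤ p.eval 1 * (3 * (x.k + 1) * inputSize x.enc) ^ p.natDegree := p.eval_le_mul_pow h1
      _ = p.eval 1 * (3 * (x.k + 1)) ^ p.natDegree * inputSize x.enc ^ p.natDegree := by
          rw [mul_pow, mul_assoc]
  · obtain ⟨y, hy, hy'⟩ := hq w hw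
    have e1 : x.enc.getD 1 0 = x.k := by simp [CliqueInst.enc_eq]
    rw [e1] at hy'
    exact ⟨y, hy, hy'.le⟩

/-! ### Traces of nondeterministic Turing machines -/

namespace NTM

variable {M : NTM}

/-- A move that the machine can make. -/
structure Move (M : NTM) where
  src : M.Λ
  read : M.Γ
  dst : M.Λ
  write : M.Γ
  dir : Turing.Dir
  mem : (dst, write, dir) ∈ M.trans src read

instance : Finite M.Move := by
  have : Finite Turing.Dir :=
    Finite.of_injective (fun d => d = Turing.Dir.left) fun a b h => by cases a <;> cases b <;> simp_all
  refine Finite.of_injective (fun m : M.Move => (m.src, m.read, m.dst, m.write, m.dir)) ?_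
  rintro ⟨⟩ ⟨⟩ h
  simp only [Prod.mk.injEq] at h
  obtain ⟨rfl, rfl, rfl, rfl, rfl⟩ := h
  rfl

/-- The symbol written by a move; idling counts as writing a blank. -/
def written (a : Option M.Move) : M.Γ := a.elim default Move.write

/-- The direction of a move; idling counts as moving left. -/
def direction (a : Option M.Move) : Turing.Dir := a.elim .left Move.dir

/-- The tape after the first moves of a sequence. -/
def tapeAt (S : Turing.Tape M.Γ) (m : ℕ → Option M.Move) : ℕ → Turing.Tape M.Γ
  | 0 => S
  | i + 1 => ((tapeAt S m i).write (written (m i))).move (direction (m i))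

/-- The position of the head after the first moves of a sequence. -/
def pos (m : ℕ → Option M.Move) : ℕ → ℤ
  | 0 => 0
  | i + 1 => pos m i + if direction (m i) = .left then -1 else 1

theorem abs_pos_le (m : ℕ → Option M.Move) (i : ℕ) : |pos m i| ≤ i := by
  induction i with
  | zero => simp [pos]
  | succ i ih =>
    rw [abs_le] at ih ⊢
    simp only [pos]
    push_cast
    split_ifs <;> omega

/-- Tapes are indexed relative to the head; subtracting `pos` gives a cell a fixed address `z` for
the whole run. -/
theorem nth_tapeAt_succ (S : Turing.Tape M.Γ) (m : ℕ → Option M.Move) (i : ℕ) (z : ℤ) :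
    (tapeAt S m (i + 1)).nth (z - pos m (i + 1)) =
      if z = pos m i then written (m i) else (tapeAt S m i).nth (z - pos m i) := by
  simp only [tapeAt, pos]
  rcases hd : direction (m i)
  · rw [Turing.Tape.move_left_nth, Turing.Tape.write_nth, if_pos rfl,
      show z - (pos m i + -1) - 1 = z - pos m i by ring]
    simp only [sub_eq_zero]
  · simp only [reduceCtorEq, if_false]
    rw [Turing.Tape.move_right_nth, Turing.Tape.write_nth,
      show z - (pos m i + 1) + 1 = z - pos m i by ring]
    simp only [sub_eq_zero]

theorem nth_tapeAt_of_not_visited (S : Turing.Tape M.Γ) (m : ℕ → Option M.Move) {i : ℕ} {z : ℤ}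
    (h : ∀ k < i, pos m k ≠ z) : (tapeAt S m i).nth (z - pos m i) = S.nth z := by
  induction i with
  | zero => simp [tapeAt, pos]
  | succ i ih =>
    rw [nth_tapeAt_succ, if_neg (h i (by omega)).symm, ih fun k hk => h k (by omega)]

theorem nth_tapeAt_of_last_visit (S : Turing.Tape M.Γ) (m : ℕ → Option M.Move) {i l : ℕ} {z : ℤ}
    (hl : l < i) (hz : pos m l = z) (h : ∀ k, l < k → k < i → pos m k ≠ z) :
    (tapeAt S m i).nth (z - pos m i) = written (m l) := by
  induction i with
  | zero => omega
  | succ i ih =>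
    rw [nth_tapeAt_succ]
    rcases Nat.lt_succ_iff_lt_or_eq.1 hl with hl' | rfl
    · rw [if_neg (h i hl' (by omega)).symm, ih hl' fun k h1 h2 => h k h1 (by omega)]
    · rw [if_pos hz.symm]

/-- Two entries of a trace of length `T` are compatible. An entry consists of the time `s`, the
position `h` of the head (shifted by `T`), the time `l` after the last visit of this position
(`0` if there was none), and the next move `a`, or `none` when the machine has accepted. -/
def Compat (M : NTM) (T : ℕ) (ini : ℕ → M.Γ) (s h l : ℕ) (a : Option M.Move)
    (s' h' l' : ℕ) (a' : Option M.Move) : Prop :=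
  (s = T → a = none) ∧
  (s = 0 → h = T ∧ (a = none → M.start ∈ M.accept) ∧ ∀ m ∈ a, m.src = M.start) ∧
  l ≤ s ∧
  (l = 0 → ∀ m ∈ a, m.read = ini h) ∧
  (s' = s + 1 →
    ((a = none → a' = none) ∧ (a' = none → ∀ m ∈ a, m.dst ∈ M.accept) ∧
      ∀ m ∈ a, ∀ m' ∈ a', m'.src = m.dst) ∧
    (direction a = .left → h' + 1 = h) ∧ (direction a = .right → h' = h + 1)) ∧
  (s < s' → l' ≤ s → h ≠ h') ∧
  (l' = s + 1 → h = h' ∧ ∀ m ∈ a', m.read = written a)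

/-- The symbol at position `h - T` of a tape that holds the word `inp`. -/
def iniSym (M : NTM) (T : ℕ) (inp : List ℕ) (h : ℕ) : M.Γ :=
  if T ≤ h ∧ h - T < inp.length then M.sym (decide (inp.getD (h - T) 0 ≠ 0)) else default

theorem iniSym_eq (T : ℕ) (x : List Bool) (h : ℕ) :
    M.iniSym T (x.map Bool.toNat) h = (Turing.Tape.mk₁ (x.map M.sym)).nth ((h : ℤ) - T) := by
  rw [iniSym, Turing.Tape.mk₁, Turing.Tape.mk₂]
  by_cases hT : T ≤ h
  · obtain ⟨k, rfl⟩ := Nat.exists_eq_add_of_le hT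
    rw [show ((T + k : ℕ) : ℤ) - T = (k : ℕ) by push_cast; ring, Turing.Tape.mk'_nth_nat,
      Turing.ListBlank.nth_mk, Nat.add_sub_cancel_left]
    by_cases hk : k < x.length
    · rw [if_pos ⟨hT, by simpa using hk⟩, List.getI_eq_getElem _ (by simpa using hk)]
      simp only [List.getElem_map, List.getD_eq_getElem?_getD, List.getElem?_map,
        List.getElem?_eq_getElem hk, Option.map_some, Option.getD_some]
      cases x[k] <;> rfl
    · rw [if_neg (by simp; omega), List.getI_eq_default _ (by simpa using hk)]
  · rw [if_neg (by omega)]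
    obtain ⟨k, hk⟩ : ∃ k : ℕ, (h : ℤ) - T = Int.negSucc k := ⟨T - h - 1, by omega⟩
    rw [hk]
    simp [Turing.Tape.nth, Turing.Tape.mk']

/-- The last two clauses of `Compat` force `l` to be the time after the true last visit: the cell
was scanned at time `l - 1` and not since. The symbol read is therefore the one written then, or the
initial one if `l = 0`. The computation ends at the first idle entry. -/
theorem acceptsWithin_of_compat {x : List Bool} {T : ℕ} {h l : ℕ → ℕ} {m : ℕ → Option M.Move}
    (hc : ∀ s ≤ T, ∀ s' ≤ T, M.Compat T (M.iniSym T (x.map Bool.toNat)) s (h s) (l s) (m s)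
      s' (h s') (l s') (m s')) : M.AcceptsWithin x T := by
  classical
  have hT : ∃ s, m s = none := ⟨T, (hc T le_rfl T le_rfl).1 rfl⟩
  set t := Nat.find hT with ht
  have htT : t ≤ T := Nat.find_min' hT ((hc T le_rfl T le_rfl).1 rfl)
  have hmt : m t = none := Nat.find_spec hT
  have hsome : ∀ i < t, ∃ a, m i = some a := fun i hi =>
    Option.ne_none_iff_exists'.1 (Nat.find_min hT hi)
  set S := Turing.Tape.mk₁ (x.map M.sym) with hS
  have hpos : ∀ i ≤ T, (h i : ℤ) = T + pos m i := by
    intro i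
    induction i with
    | zero =>
      intro hi
      simp [pos, ((hc 0 hi 0 hi).2.1 rfl).1]
    | succ i ih =>
      intro hi
      have := ih (by omega)
      obtain ⟨-, hl, hr⟩ := (hc i (by omega) (i + 1) hi).2.2.2.2.1 rfl
      simp only [pos]
      rcases hd : direction (m i)
      · have := hl hd
        rw [if_pos rfl]
        omega
      · have := hr hd
        rw [if_neg (by simp)]
        omega
  have hread : ∀ i < t, ∀ a ∈ m i, a.read = (tapeAt S m i).head := by
    intro i hi a ha
    rw [← Turing.Tape.nth_zero, ← sub_self (pos m i)]
    have hii := hc i (by omega) i (by omega)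
    have hpi := hpos i (by omega)
    rcases hl : l i with _ | k
    · rw [nth_tapeAt_of_not_visited, hii.2.2.2.1 hl a ha, iniSym_eq]
      · congr 1
        omega
      · intro k hk he
        have := (hc k (by omega) i (by omega)).2.2.2.2.2.1 hk (by omega)
        have := hpos k (by omega)
        omega
    · have hli := hii.2.2.1
      have hki := (hc k (by omega) i (by omega)).2.2.2.2.2.2 hl
      have hpk := hpos k (by omega)
      rw [nth_tapeAt_of_last_visit (l := k) S m (by omega) (by omega), hki.2 a ha]
      intro k' hk hk' he
      have := (hc k' (by omega) i (by omega)).2.2.2.2.2.1 hk' (by omega)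
      have := hpos k' (by omega)
      omega
  -- The state at time `k + 1` is the target of move `k`; the fallback for idle entries is not
  -- reached up to time `t`.
  set st : ℕ → M.Λ := fun i => Nat.casesOn i M.start fun k => (m k).elim M.start Move.dst with hst
  refine ⟨t, fun i => ⟨st i, tapeAt S m i⟩, htT, rfl, fun i hi => ?_, ?_⟩
  · obtain ⟨a, ha⟩ := hsome i hi
    have hsrc : st i = a.src := by
      cases i with
      | zero => exact (((hc 0 (by omega) 0 (by omega)).2.1 rfl).2.2 a ha).symm
      | succ i =>
        obtain ⟨b, hb⟩ := hsome i (by omega)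
        have := ((hc i (by omega) (i + 1) (by omega)).2.2.2.2.1 rfl).1.2.2 b hb a ha
        simp [hst, hb, this]
    refine ⟨a.write, a.dir, ?_, ?_⟩
    · have e : st (i + 1) = a.dst := by simp [hst, ha]
      dsimp only
      rw [e, hsrc, ← hread i hi a ha]
      exact a.mem
    · simp [tapeAt, ha, written, direction]
  · dsimp only
    rcases h0 : t with _ | k
    · rw [h0] at hmt
      exact ((hc 0 (by omega) 0 (by omega)).2.1 rfl).2.1 hmt
    · obtain ⟨b, hb⟩ := hsome k (by omega)
      rw [h0] at hmt
      have := ((hc k (by omega) (k + 1) (by omega)).2.2.2.2.1 rfl).1.2.1 hmt b hb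
      simpa [hst, hb] using this

theorem exists_compat_of_acceptsWithin {x : List Bool} {T : ℕ} (hx : M.AcceptsWithin x T) :
    ∃ (h l : ℕ → ℕ) (m : ℕ → Option M.Move), (∀ s ≤ T, h s ≤ 2 * T ∧ l s ≤ T) ∧
      ∀ s ≤ T, ∀ s' ≤ T, M.Compat T (M.iniSym T (x.map Bool.toNat)) s (h s) (l s) (m s)
        s' (h s') (l s') (m s') := by
  classical
  obtain ⟨t, C, htT, h0, hstep, hacc⟩ := hx
  choose! b d hbd htape using hstep
  -- After acceptance the trace is padded with idle entries, which go on moving left; all positions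
  -- stay within distance `T` of the start.
  set m : ℕ → Option M.Move := fun i => if hi : i < t then
    some ⟨(C i).state, (C i).tape.head, (C (i + 1)).state, b i, d i, hbd i hi⟩ else none with hm
  have hms : ∀ i, ∀ a ∈ m i, i < t ∧ a.src = (C i).state ∧ a.read = (C i).tape.head ∧
      a.dst = (C (i + 1)).state ∧ written (m i) = b i ∧ direction (m i) = d i := by
    intro i a ha
    by_cases hi : i < t
    · simp only [hm, hi, dif_pos, Option.mem_def, Option.some.injEq] at ha
      subst ha
      simp [hm, hi, written, direction]
    · simp [hm, hi] at ha
  have hmn : ∀ i, m i = none ↔ t ≤ i := by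
    intro i
    by_cases hi : i < t <;> simp [hm, hi]
    omega
  set S := Turing.Tape.mk₁ (x.map M.sym) with hS
  have htp : ∀ i ≤ t, (C i).tape = tapeAt S m i := by
    intro i
    induction i with
    | zero => intro _; rw [h0]; rfl
    | succ i ih =>
      intro hi
      obtain ⟨a, ha⟩ := Option.ne_none_iff_exists'.1 (mt (hmn i).1 (by omega))
      have := hms i a ha
      rw [htape i (by omega), ih (by omega), tapeAt, this.2.2.2.2.1, this.2.2.2.2.2]
  have hp : ∀ s ≤ T, ((T + pos m s).toNat : ℤ) = T + pos m s := by
    intro s hs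
    have := abs_le.1 (abs_pos_le m s)
    omega
  -- `k` is the time after a visit of the present cell; `Nat.findGreatest` returns 0 when no such
  -- `k` exists, as `Compat` expects.
  set P : ℕ → ℕ → Prop := fun s k => 0 < k ∧ pos m (k - 1) = pos m s with hP
  have hl0 : ∀ s k, Nat.findGreatest (P s) s ≤ k → k < s → pos m k ≠ pos m s := by
    intro s k h1 h2 he
    have := Nat.le_findGreatest (P := P s) (n := s) (m := k + 1) (by omega) ⟨by omega, he⟩
    omega
  have hls : ∀ s k, Nat.findGreatest (P s) s = k + 1 → k < s ∧ pos m k = pos m s := by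
    intro s k h1
    have h2 := Nat.findGreatest_le (P := P s) s
    exact ⟨by omega, (Nat.findGreatest_of_ne_zero h1 (by omega)).2⟩
  have hhead : ∀ s, ∀ a ∈ m s, a.read = (tapeAt S m s).nth (pos m s - pos m s) := by
    intro s a ha
    obtain ⟨h1, -, h2, -⟩ := hms s a ha
    rw [sub_self, Turing.Tape.nth_zero, h2, htp s h1.le]
  refine ⟨fun s => (T + pos m s).toNat, fun s => Nat.findGreatest (P s) s, m, fun s hs => ?_, ?_⟩
  · change (T + pos m s).toNat ≤ 2 * T ∧ Nat.findGreatest (P s) s ≤ T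
    have := abs_le.1 (abs_pos_le m s)
    have := Nat.findGreatest_le (P := P s) s
    omega
  · intro s hs s' hs'
    have hps := hp s hs
    have hps' := hp s' hs'
    change M.Compat T _ s (T + pos m s).toNat (Nat.findGreatest (P s) s) (m s)
      s' (T + pos m s').toNat (Nat.findGreatest (P s') s') (m s')
    refine ⟨?_, ?_, Nat.findGreatest_le s, ?_, ?_, ?_, ?_⟩
    · rintro rfl
      exact (hmn s).2 htT
    · rintro rfl
      refine ⟨by simp [pos], fun h => ?_, fun a ha => ?_⟩
      · obtain rfl : t = 0 := by simpa using (hmn 0).1 h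
        rwa [h0] at hacc
      · rw [(hms 0 a ha).2.1, h0]
        rfl
    · intro hl a ha
      rw [hhead s a ha, nth_tapeAt_of_not_visited S m fun k hk => hl0 s k (by omega) hk, iniSym_eq]
      congr 1
      omega
    · rintro rfl
      refine ⟨⟨fun h => ?_, fun h a ha => ?_, fun a ha a' ha' => ?_⟩, fun h => ?_, fun h => ?_⟩
      · rw [hmn] at h ⊢
        omega
      · obtain ⟨h1, -, -, h2, -⟩ := hms s a ha
        rw [hmn] at h
        obtain rfl : t = s + 1 := by omega
        rwa [h2]
      · rw [(hms _ a' ha').2.1, (hms s a ha).2.2.2.1]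
      · simp only [pos, h, if_true] at hps'
        simp only [pos, h, if_true]
        omega
      · simp only [pos, h, reduceCtorEq, if_false] at hps'
        simp only [pos, h, reduceCtorEq, if_false]
        omega
    · intro hlt hl he
      exact hl0 s' s hl hlt (by omega)
    · intro hl
      obtain ⟨h1, h2⟩ := hls s' s hl
      refine ⟨by rw [h2], fun a ha => ?_⟩
      rw [hhead s' a ha, nth_tapeAt_of_last_visit S m h1 h2]
      exact fun k hk hk' => hl0 s' k (by omega) hk'

end NTM

/-! ### NP-hardness -/

theorem hasCliqueSet_of_fun {X : Type*} {N T : ℕ} {τ : ℕ → ℕ} {δ : ℕ → X}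
    {Q : ℕ → X → ℕ → X → Prop} (x : ℕ → X) (hx : ∀ s ≤ T, ∃ i < N, τ i = s ∧ δ i = x s)
    (hQ : ∀ s ≤ T, ∀ s' ≤ T, Q s (x s) s' (x s')) :
    HasCliqueSet N (T + 1) fun i j =>
      (τ i = τ j → i = j) ∧ τ i ≤ T ∧ Q (τ i) (δ i) (τ j) (δ j) := by
  choose! f hf hτ hδ using hx
  have hmem : ∀ s, s ∈ Finset.range (T + 1) ↔ s ≤ T := fun s => Finset.mem_range_succ_iff
  refine ⟨(Finset.range (T + 1)).image f, ?_, ?_, ?_⟩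
  · refine Finset.image_subset_iff.2 fun s hs => Finset.mem_range.2 (hf s ((hmem s).1 hs))
  · rw [Finset.card_image_of_injOn, Finset.card_range]
    intro s hs s' hs' h
    have hs := (hmem s).1 hs
    have hs' := (hmem s').1 hs'
    rw [← hτ s hs, ← hτ s' hs']
    exact congrArg τ h
  · intro i hi j hj
    obtain ⟨s, hs, rfl⟩ := Finset.mem_image.1 hi
    obtain ⟨s', hs', rfl⟩ := Finset.mem_image.1 hj
    rw [hmem] at hs hs'
    rw [hτ s hs, hτ s' hs', hδ s hs, hδ s' hs']
    exact ⟨fun h => by rw [h], hs, hQ s hs s' hs'⟩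

/-- The time stamps `τ` are injective on the clique set, and its `T + 1` members have stamps at most
`T`, so each time occurs. -/
theorem exists_fun_of_hasCliqueSet {X : Type*} {N T : ℕ} {τ : ℕ → ℕ} {δ : ℕ → X}
    {Q : ℕ → X → ℕ → X → Prop} (h : HasCliqueSet N (T + 1) fun i j =>
      (τ i = τ j → i = j) ∧ τ i ≤ T ∧ Q (τ i) (δ i) (τ j) (δ j)) :
    ∃ x : ℕ → X, ∀ s ≤ T, ∀ s' ≤ T, Q s (x s) s' (x s') := by
  obtain ⟨S, -, hS, hR⟩ := h
  have himg : S.image τ = Finset.range (T + 1) := by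
    refine Finset.eq_of_subset_of_card_le (Finset.image_subset_iff.2 fun i hi =>
      Finset.mem_range_succ_iff.2 (hR i hi i hi).2.1) ?_
    rw [Finset.card_image_of_injOn fun i hi j hj h => (hR i hi j hj).1 h, hS, Finset.card_range]
  have : ∀ s ≤ T, ∃ i ∈ S, τ i = s := fun s hs =>
    Finset.mem_image.1 (himg ▸ Finset.mem_range_succ_iff.2 hs)
  choose! f hf hτ using this
  refine ⟨fun s => δ (f s), fun s hs s' hs' => ?_⟩
  have := (hR _ (hf s hs) _ (hf s' hs')).2.2
  rwa [hτ s hs, hτ s' hs'] at this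

/-- Reduction modulo `D` makes decoding total, and every relation on a finite type is a finite
table. -/
theorem exists_decoder (A : Type) [Finite A] [Nonempty A] : ∃ (D : ℕ) (dec : ℕ → A),
    (∀ a, ∃ n < D, dec n = a) ∧ ∀ (Q : A → A → Prop) (f g : List ℕ → (ℕ → ℕ) → ℕ),
      Definable f → Definable g → DefinablePred fun inp v => Q (dec (f inp v)) (dec (g inp v)) := by
  obtain ⟨D, ⟨e⟩⟩ := Finite.exists_equiv_fin A
  have hD : 0 < D := (e (Classical.arbitrary A)).pos
  refine ⟨D, fun n => e.symm ⟨n % D, Nat.mod_lt _ hD⟩, fun a => ⟨e a, (e a).2, ?_⟩,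
    fun Q f g hf hg => ?_⟩
  · rw [Equiv.symm_apply_eq]
    ext
    exact Nat.mod_eq_of_lt (e a).2
  · refine (DefinablePred.table₂ (hf.mod (.const D)) (hg.mod (.const D)) (fun k k' =>
      ∀ (hk : k < D) (hk' : k' < D), Q (e.symm ⟨k, hk⟩) (e.symm ⟨k', hk'⟩)) D).congr fun inp v => ?_
    exact ⟨fun h => h.2 h.1.1 h.1.2, fun h => ⟨⟨Nat.mod_lt _ hD, Nat.mod_lt _ hD⟩, fun _ _ => h⟩⟩

/-- The base-`W` digits of a number, the last one unrestricted. -/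
theorem exists_digits {W D s h l n : ℕ} (hs : s < W) (hh : h < W) (hl : l < W) (hn : n < D)
    (hD : D ≤ W) : ∃ i < W * (W * (W * W)), i % W = s ∧ i / W % W = h ∧ i / W / W % W = l ∧
      i / W / W / W = n := by
  have hW : 0 < W := by omega
  have key : ∀ a b, a < W → (a + W * b) % W = a ∧ (a + W * b) / W = b := fun a b ha =>
    ⟨by rw [Nat.add_mul_mod_self_left, Nat.mod_eq_of_lt ha],
      by rw [Nat.add_mul_div_left _ _ hW, Nat.div_eq_of_lt ha, zero_add]⟩
  have bd : ∀ a b c, a < W → b < c → a + W * b < W * c := fun a b c ha hb => by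
    calc a + W * b < W + W * b := by omega
      _ = W * (b + 1) := by ring
      _ ≤ W * c := Nat.mul_le_mul_left _ hb
  refine ⟨s + W * (h + W * (l + W * n)), bd _ _ _ hs (bd _ _ _ hh (bd _ _ _ hl (by omega))), ?_⟩
  rw [(key s _ hs).2, (key h _ hh).2, (key l _ hl).2]
  exact ⟨(key s _ hs).1, (key h _ hh).1, (key l _ hl).1, rfl⟩

theorem definablePred_compat (M : NTM) {T : List ℕ → ℕ} (hT : Definable fun inp _ => T inp)
    {dec : ℕ → Option M.Move} (hdec : ∀ (Q : Option M.Move → Option M.Move → Prop)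
      (f g : List ℕ → (ℕ → ℕ) → ℕ), Definable f → Definable g →
      DefinablePred fun inp v => Q (dec (f inp v)) (dec (g inp v)))
    {s h l a s' h' l' a' : List ℕ → (ℕ → ℕ) → ℕ} (ds : Definable s) (dh : Definable h)
    (dl : Definable l) (da : Definable a) (ds' : Definable s') (dh' : Definable h')
    (dl' : Definable l') (da' : Definable a') :
    DefinablePred fun inp v => M.Compat (T inp) (M.iniSym (T inp) inp)
      (s inp v) (h inp v) (l inp v) (dec (a inp v))
      (s' inp v) (h' inp v) (l' inp v) (dec (a' inp v)) := by
  have un : ∀ Q : Option M.Move → Prop, DefinablePred fun inp v => Q (dec (a inp v)) :=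
    fun Q => hdec (fun x _ => Q x) a a da da
  have bi : ∀ Q : Option M.Move → Option M.Move → Prop,
      DefinablePred fun inp v => Q (dec (a inp v)) (dec (a' inp v)) :=
    fun Q => hdec Q a a' da da'
  have d1 : Definable fun inp v => s inp v + 1 := ds.add (.const 1)
  -- The initial symbol takes only three values, so this clause splits into cases, each with a fixed
  -- condition on the move.
  have dini : DefinablePred fun inp v => ∀ m ∈ dec (a inp v),
      m.read = M.iniSym (T inp) inp (h inp v) := by
    have dc := (DefinablePred.le hT dh).and (DefinablePred.lt (dh.sub hT) Definable.length)
    have de := DefinablePred.eq (dh.sub hT).entry (.const 0)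
    refine ((dc.imp ((de.imp (un fun x => ∀ m ∈ x, m.read = M.sym false)).and
      (de.not.imp (un fun x => ∀ m ∈ x, m.read = M.sym true)))).and
      (dc.not.imp (un fun x => ∀ m ∈ x, m.read = default))).congr fun inp v => ?_
    rw [NTM.iniSym]
    by_cases hc : T inp ≤ h inp v ∧ h inp v - T inp < inp.length
    · by_cases he : inp.getD (h inp v - T inp) 0 = 0
      · simp only [hc, he, and_self, true_imp_iff, not_true, false_imp_iff, and_true, if_true,
          ne_eq, decide_false]
      · simp only [hc, he, and_self, true_imp_iff, not_true, false_imp_iff, and_true, if_true,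
          ne_eq, not_false_iff, decide_true, true_and]
    · simp only [hc, false_imp_iff, not_false_iff, true_imp_iff, true_and, if_false]
  exact ((DefinablePred.eq ds hT).imp (un (· = none))).and <|
    ((DefinablePred.eq ds (.const 0)).imp ((DefinablePred.eq dh hT).and
      (un fun x => (x = none → M.start ∈ M.accept) ∧ ∀ m ∈ x, m.src = M.start))).and <|
    (DefinablePred.le dl ds).and <|
    ((DefinablePred.eq dl (.const 0)).imp dini).and <|
    ((DefinablePred.eq ds' d1).imp ((bi fun x y => (x = none → y = none) ∧
      (y = none → ∀ m ∈ x, m.dst ∈ M.accept) ∧ ∀ m ∈ x, ∀ m' ∈ y, m'.src = m.dst).and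
      (((un fun x => NTM.direction x = .left).imp (DefinablePred.eq (dh'.add (.const 1)) dh)).and
      ((un fun x => NTM.direction x = .right).imp
        (DefinablePred.eq dh' (dh.add (.const 1))))))).and <|
    ((DefinablePred.lt ds ds').imp ((DefinablePred.le dl' ds).imp (DefinablePred.eq dh dh').not)).and
    ((DefinablePred.eq dl' d1).imp ((DefinablePred.eq dh dh').and
      (bi fun x y => ∀ m ∈ y, m.read = NTM.written x)))

theorem npHard_approxLeftIS (c : ℝ) : NPHard (approxLeftIS c) := by
  rintro L ⟨M, q, hL⟩
  obtain ⟨D, dec, hsurj, hdec⟩ := exists_decoder (Option M.Move)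
  set T : List ℕ → ℕ := fun inp => q.eval inp.length with hTdef
  -- The base exceeds all times (at most `T`), all shifted positions (at most `2 * T`) and all move
  -- codes (less than `D`).
  set W : List ℕ → ℕ := fun inp => 2 * T inp + 1 + D with hWdef
  have dT : Definable fun inp _ => T inp := Definable.length.polynomial q
  have dW : Definable fun inp _ => W inp :=
    (((Definable.const 2).mul dT).add (.const 1)).add (.const D)
  set data : List ℕ → ℕ → ℕ × ℕ × Option M.Move := fun inp i =>
    (i / W inp % W inp, i / W inp / W inp % W inp, dec (i / W inp / W inp / W inp)) with hdata
  set Q : List ℕ → ℕ → ℕ × ℕ × Option M.Move → ℕ → ℕ × ℕ × Option M.Move → Prop :=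
    fun inp s y s' y' => M.Compat (T inp) (M.iniSym (T inp) inp) s y.1 y.2.1 y.2.2
      s' y'.1 y'.2.1 y'.2.2 with hQdef
  obtain ⟨P, p, hP⟩ := exists_reduction (c := c)
    (N := fun inp => W inp * (W inp * (W inp * W inp))) (K := fun inp => T inp + 1)
    (R := fun inp i j => (i % W inp = j % W inp → i = j) ∧ i % W inp ≤ T inp ∧
      Q inp (i % W inp) (data inp i) (j % W inp) (data inp j))
    (dW.mul (dW.mul (dW.mul dW))) (dT.add (.const 1)) (by
      intro f g hf hg
      have hfd := hf.div dW
      have hgd := hg.div dW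
      have hfdd := hfd.div dW
      have hgdd := hgd.div dW
      exact ((DefinablePred.eq (hf.mod dW) (hg.mod dW)).imp (DefinablePred.eq hf hg)).and
        ((DefinablePred.le (hf.mod dW) dT).and
          (definablePred_compat M dT hdec (hf.mod dW) (hfd.mod dW) (hfdd.mod dW) (hfdd.div dW)
            (hg.mod dW) (hgd.mod dW) (hgdd.mod dW) (hgdd.div dW))))
  -- The magnitude of a list of bits is at most twice its length.
  refine ⟨P, p.comp (2 * .X), fun Ω hΩ x => ?_⟩
  obtain ⟨⟨t, ht, b, hb, hb'⟩, hq⟩ := hP Ω hΩ (x.map Bool.toNat)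
  refine ⟨⟨t, ht.trans ?_, b, hb, hb'.trans ?_⟩, fun w hw => ?_⟩
  · rw [Polynomial.eval_comp]
    refine polynomial_eval_mono p ?_
    have h1 := List.sum_le_card_nsmul (x.map Bool.toNat) 1 (by
      intro y hy
      obtain ⟨u, -, rfl⟩ := List.mem_map.1 hy
      exact Bool.toNat_le u)
    simp only [List.length_map, smul_eq_mul, mul_one] at h1
    simp only [magnitude, List.length_map, Polynomial.eval_mul, Polynomial.eval_ofNat,
      Polynomial.eval_X]
    omega
  · have hTx : T (x.map Bool.toNat) = q.eval x.length := by simp [hTdef]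
    rw [hL x, ← hTx]
    constructor
    · intro h
      obtain ⟨y, hy⟩ := exists_fun_of_hasCliqueSet h
      exact NTM.acceptsWithin_of_compat (h := fun s => (y s).1) (l := fun s => (y s).2.1)
        (m := fun s => (y s).2.2) hy
    · intro h
      obtain ⟨h, l, m, hbd, hc⟩ := NTM.exists_compat_of_acceptsWithin h
      refine hasCliqueSet_of_fun (Q := Q (x.map Bool.toNat)) (fun s => (h s, l s, m s))
        (fun s hs => ?_) hc
      obtain ⟨n, hn, hnm⟩ := hsurj (m s)
      obtain ⟨h1, h2⟩ := hbd s hs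
      obtain ⟨i, hi, e1, e2, e3, e4⟩ := exists_digits (W := W (x.map Bool.toNat)) (s := s)
        (h := h s) (l := l s) (by simp only [W]; omega) (by simp only [W]; omega)
        (by simp only [W]; omega) hn (by simp only [W]; omega)
      exact ⟨i, hi, e1, by rw [← hnm, ← e2, ← e3, ← e4]⟩
  · obtain ⟨y, hy, -⟩ := hq w hw
    exact ⟨y, hy⟩

theorem mainTheorem2 (c : ℝ) (hc : 0 ≤ c) :
    NPHard (approxLeftIS c) ∧ W1Hard (approxLeftIS c) :=
  ⟨npHard_approxLeftIS c, w1Hard_approxLeftIS c⟩
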